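/- **Conventions.** A left-ordering of a group $G$ is a strict total order $<$ on $G$ such that $g<h$ implies $fg<fh$ for all $f,g,h\in G$. A subgroup $C\le G$ is convex relative to $<$ if $a<g<b$ with $a,b\in C$ and $g\in G$ implies $g\in C$. For a well-ordering $\prec$ of $\mathbb{R}$, the left-ordering of $\mathrm{Homeo}_+(\mathbb{R})$ determined by $\prec$ is the one with positive cone $$P=\{f\neq \mathrm{id} : f(x_f)>x_f\},\qquad x_f=\min\nolimits_{\prec}\{x : f(x)\neq x\},$$ that is, $f$ is less than $g$ if and only if $f^{-1}g\in P$. A left-ordering of a group $G$ is natural if it is the pull-back of such a left-ordering, for some well-ordering $\prec$ of $\mathbb{R}$, along some injective homomorphism $G\to\mathrm{Homeo}_+(\mathbb{R})$; otherwise it is unnatural. A circular ordering of $G$ is a function $c:G^3\to\{0,\pm1\}$ such that * $c(g_1,g_2,g_3)=0$ if and only if $g_1,g_2,g_3$ are not all distinct; * $c(g_1,g_2,g_3)-c(g_1,g_2,g_4)+c(g_1,g_3,g_4)-c(g_2,g_3,g_4)=0$ for all $g_1,\dots,g_4\in G$; * $c(gg_1,gg_2,gg_3)=c(g_1,g_2,g_3)$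 for all $g,g_1,g_2,g_3\in G$. For a well-ordering $\prec$ of $S^1$ with least element $p$, the stabilizer of $p$ in $\mathrm{Homeo}_+(S^1)$ acts on the oriented line $S^1\setminus\{p\}\cong\mathbb{R}$, and is left-ordered as above using $\prec$. The circular ordering of $\mathrm{Homeo}_+(S^1)$ determined by $\prec$ is the lexicographic one built from this left-ordering and from the cyclic order of $S^1$ on the orbit of $p$. Explicitly, write $f\lhd g$ if $f(p)=g(p)$ and $f^{-1}g$ is positive in the stabilizer of $p$. Then, for distinct $f,g,h$, the triple $(f,g,h)$ has value $1$ if and only if one of the following holds, and value $-1$ otherwise: * $f(p),g(p),h(p)$ are distinct and positively oriented; * exactly two of $f(p),g(p),h(p)$ are equal and, after a cyclic permutation of $(f,g,h)$, $f(p)=g(p)\neq h(p)$ and $f\lhd g$; * all three are equal and, after a cyclic permutation of $(f,g,h)$, $f\lhd g\lhd h$. A circular ordering of $G$ is natural if it is the pull-back of such a circular ordering, for some well-ordering $\prec$ of $S^1$, along some injective homomorphism $G\to\mathrm{Homeo}_+(S^1)$; otherwise it is unnatural. **Proposition.** Let $F(X)$ be the free group with free generating set $X=\{x_r\}_{r\in\mathbb{R}}$.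 For $S\subset\mathbb{R}$, let $F(X_S)$ be the subgroup generated by $\{x_r\}_{r\in S}$. Call $S$ downward-closed if $x\in S$ and $y<x$ imply $y\in S$. 1. There is a left-ordering of $F(X)$ relative to which $F(X_S)$ is convex for every downward-closed $S\subset\mathbb{R}$. 2. Every left-ordering of $F(X)$ as in (1) is unnatural. 3. There is an injective homomorphism $F(X)\to\mathrm{Homeo}_+(\mathbb{R})$, and $F(X)$ admits both natural and unnatural left-orderings. 4. There is a group that admits both natural and unnatural circular orderings. -/

import Mathlib

namespace NatOrd

/-- `lt` is a (strict) left-ordering of the group `G`. -/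
structure IsLeftOrdering {G : Type*} [Group G] (lt : G → G → Prop) : Prop where
  strictTotal : IsStrictTotalOrder G lt
  mul_left : ∀ f g h : G, lt g h → lt (f * g) (f * h)

/-- The subgroup `C` is convex relative to `lt`. -/
def IsConvex {G : Type*} [Group G] (lt : G → G → Prop) (C : Subgroup G) : Prop :=
  ∀ a ∈ C, ∀ b ∈ C, ∀ g : G, lt a g → lt g b → g ∈ C

/-- `F(X_S)`: the subgroup of the free group on `x_r`, `r ∈ ℝ`, generated by the `x_r`
with `r ∈ S`. -/
def freeSub (S : Set ℝ) : Subgroup (FreeGroup ℝ) :=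
  Subgroup.closure (FreeGroup.of '' S)

/-- `lt` is a left-ordering of `F(X)` relative to which `F(X_S)` is convex for every
downward-closed set `S` of reals. -/
def IsInitiallyConvexOrdering (lt : FreeGroup ℝ → FreeGroup ℝ → Prop) : Prop :=
  IsLeftOrdering lt ∧
    ∀ S : Set ℝ, (∀ x y : ℝ, x ∈ S → y < x → y ∈ S) → IsConvex lt (freeSub S)

/-- `Homeo₊(ℝ)`, the group of orientation-preserving (that is, order-preserving) homeomorphisms
of the line, under composition. -/
def HomeoPlusReal : Subgroup (ℝ ≃ₜ ℝ) where
  carrier := {f | ∀ x y : ℝ, f x < f y ↔ x < y}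
  one_mem' := fun _ _ => Iff.rfl
  mul_mem' := by
    intro f g hf hg x y
    exact (hf (g x) (g y)).trans (hg x y)
  inv_mem' := by
    intro f hf x y
    have h := hf (f.symm x) (f.symm y)
    rw [f.apply_symm_apply, f.apply_symm_apply] at h
    exact h.symm

/-- The circle `ℝ / ℤ`, with the cyclic order of Mathlib: `sbtw a b c` says that `a`, `b`, `c`
are distinct and are met in this order when the circle is traversed in the positive direction. -/
abbrev S1 : Type := UnitAddCircle

/-- `Homeo₊(S¹)`, the group of orientation-preserving (that is, cyclic-order-preserving)
homeomorphisms of the circle, under composition. -/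
noncomputable def HomeoPlusCircle : Subgroup (S1 ≃ₜ S1) where
  carrier := {f | ∀ x y z : S1, sbtw (f x) (f y) (f z) ↔ sbtw x y z}
  one_mem' := fun _ _ _ => Iff.rfl
  mul_mem' := by
    intro f g hf hg x y z
    exact (hf (g x) (g y) (g z)).trans (hg x y z)
  inv_mem' := by
    intro f hf x y z
    have h := hf (f.symm x) (f.symm y) (f.symm z)
    rw [f.apply_symm_apply, f.apply_symm_apply, f.apply_symm_apply] at h
    exact h.symm

/-- The standard positive cone, for `Ω` ordered by `lt` and well-ordered by `r`: the map `f`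
moves some point, and `x < f x` for the `r`-least point `x` moved by `f`. -/
def IsStdPositive {Ω : Type*} (lt r : Ω → Ω → Prop) (f : Ω → Ω) : Prop :=
  ∃ x : Ω, f x ≠ x ∧ (∀ y : Ω, r y x → f y = y) ∧ lt x (f x)

/-- The left-ordering of `Homeo₊(ℝ)` determined by the well-ordering `r` of `ℝ`: `f` is less than
`g` when `f⁻¹ g` lies in the standard positive cone. -/
def stdOrder (r : ℝ → ℝ → Prop) (f g : HomeoPlusReal) : Prop :=
  IsStdPositive (fun a b : ℝ => a < b) r (f⁻¹ * g : HomeoPlusReal).1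

/-- `lt` is natural: it is the pull-back, along an injective representation in `Homeo₊(ℝ)`, of
the left-ordering determined by some well-ordering of `ℝ`. -/
def IsNatural {G : Type*} [Group G] (lt : G → G → Prop) : Prop :=
  ∃ r : ℝ → ℝ → Prop, IsWellOrder ℝ r ∧
    ∃ ρ : G →* HomeoPlusReal, Function.Injective ρ ∧
      ∀ g h : G, lt g h ↔ stdOrder r (ρ g) (ρ h)

/-- `c` is a (left-)circular ordering of the group `G`. -/
structure IsCircularOrdering {G : Type*} [Group G] (c : G → G → G → SignType) : Prop where
  eq_zero_iff : ∀ f g h : G, c f g h = 0 ↔ f = g ∨ g = h ∨ f = h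
  cocycle : ∀ g₁ g₂ g₃ g₄ : G,
    (c g₁ g₂ g₃ : ℤ) - (c g₁ g₂ g₄ : ℤ) + (c g₁ g₃ g₄ : ℤ) - (c g₂ g₃ g₄ : ℤ) = 0
  mul_left : ∀ k f g h : G, c f g h = c (k * f) (k * g) (k * h)

/-- `f` and `g` lie in the same left coset of the stabilizer of `p` in `Homeo₊(S¹)`, and `f⁻¹ g`
lies in the standard positive cone of that stabilizer, regarded as acting on `S¹ ∖ {p}`. Here
`S¹ ∖ {p}` is linearly ordered by `a < b ↔ sbtw p a b` and is well-ordered by `r`. -/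
def cosetLT (r : S1 → S1 → Prop) (p : S1) (f g : HomeoPlusCircle) : Prop :=
  f.1 p = g.1 p ∧
    IsStdPositive (fun a b : S1 => sbtw p a b) r (f⁻¹ * g : HomeoPlusCircle).1

/-- The triple `(f, g, h)` is positively oriented in the lexicographic circular ordering of
`Homeo₊(S¹)` that is built from the cyclic order on the orbit of `p` (the left cosets of the
stabilizer of `p`) and the left-ordering `cosetLT` of the stabilizer of `p`.
The disjuncts: the images of `p` are distinct; exactly two of them agree; all three agree. -/
def stdPosTriple (r : S1 → S1 → Prop) (p : S1) (f g h : HomeoPlusCircle) : Prop :=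
  sbtw (f.1 p) (g.1 p) (h.1 p) ∨
  (cosetLT r p f g ∧ h.1 p ≠ f.1 p) ∨
  (cosetLT r p g h ∧ f.1 p ≠ g.1 p) ∨
  (cosetLT r p h f ∧ g.1 p ≠ h.1 p) ∨
  (cosetLT r p f g ∧ cosetLT r p g h) ∨
  (cosetLT r p g h ∧ cosetLT r p h f) ∨
  (cosetLT r p h f ∧ cosetLT r p f g)

open Classical in
/-- The circular ordering of `Homeo₊(S¹)` determined by the well-ordering `r` of `S¹` with least
element `p`. -/
noncomputable def stdCircular (r : S1 → S1 → Prop) (p : S1) (f g h : HomeoPlusCircle) : SignType :=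
  if stdPosTriple r p f g h then 1 else if stdPosTriple r p h g f then -1 else 0

/-- `c` is natural: it is the pull-back, along an injective representation in `Homeo₊(S¹)`, of
the circular ordering determined by some well-ordering of `S¹`. -/
def IsNaturalCircular {G : Type*} [Group G] (c : G → G → G → SignType) : Prop :=
  ∃ r : S1 → S1 → Prop, IsWellOrder S1 r ∧ ∃ p : S1, (∀ x : S1, ¬ r x p) ∧
    ∃ ρ : G →* HomeoPlusCircle, Function.Injective ρ ∧
      ∀ f g h : G, c f g h = stdCircular r p (ρ f) (ρ g) (ρ h)

end NatOrd

/-! Existence. On a free group over a linearly ordered alphabet, the weight (signs of letters plus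
signs of turns in the Cayley tree) is a quasimorphism of defect at most 1 (`abs_freeWeight_mul_le`)
and is odd off the identity, so positive weight defines a left-ordering. The weight is invariant
under order-preserving relabelling. The normal closure of `x_m` in `F(X_{≤m})` is free on the
conjugates of `x_m` by elements of `F(X_{<m})`. If these are ordered by their conjugators,
conjugation preserves the weight. An element is then positive when, at its largest essential index
`m`, its component in this normal closure has positive weight.

Unnaturality. Given a representation and a well-ordering, the least point moved by `F(X_{<s})` can
only descend as `s` grows, so for some `a < b` a point `x` is least both for `a` and for `b`
(`exists_common_min`). Pick `c` in `F(X_{<a})` moving `x`. The uncountably many intervals between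
`x_s x` and `x_s c x`, `a < s < b`, cannot be disjoint, but overlapping ones for `s < s'` interleave
the cosets of `c`, against convexity of `F(X_{<s'})`. On the circle, arcs replace intervals.

Naturality. `F(X)` embeds in a product of countably many copies of a countable ordered free group,
hence acts faithfully on a countable dense order, on `ℚ`, on `ℝ`, and on the circle with a fixed
point. -/

namespace NatOrd

/-! ### Reduced words and cancellation -/

section Letters

variable {Y : Type*}

/-- The inverse of a letter. -/
def letterInv (x : Y × Bool) : Y × Bool := (x.1, !x.2)

/-- The letters are linearly ordered with the inverses of generators first. -/
def letterKey (x : Y × Bool) : Bool ×ₗ Y := toLex (x.2, x.1)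

theorem letterKey_injective : Function.Injective (letterKey : Y × Bool → Bool ×ₗ Y) := by
  rintro ⟨a, b⟩ ⟨c, d⟩ h
  have := congrArg ofLex h
  simp only [letterKey, ofLex_toLex, Prod.mk.injEq] at this
  simp [this.1, this.2]

@[simp] theorem letterInv_letterInv (x : Y × Bool) : letterInv (letterInv x) = x := by
  simp [letterInv]

theorem invRev_cons (x : Y × Bool) (l : List (Y × Bool)) :
    FreeGroup.invRev (x :: l) = FreeGroup.invRev l ++ [letterInv x] := by
  simp [FreeGroup.invRev, letterInv]

theorem getLast?_invRev (l : List (Y × Bool)) :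
    (FreeGroup.invRev l).getLast? = l.head?.map letterInv := by
  simp [FreeGroup.invRev, List.getLast?_reverse]
  rfl

/-- Cancel at the junction for as long as the last letter of `l₁` is inverse to the first letter of
`l₂`; `c` is the cancelled suffix. -/
theorem exists_cancellation (l₁ l₂ : List (Y × Bool)) (h₁ : FreeGroup.IsReduced l₁)
    (h₂ : FreeGroup.IsReduced l₂) : ∃ a b c : List (Y × Bool),
      l₁ = a ++ c ∧ l₂ = FreeGroup.invRev c ++ b ∧ FreeGroup.IsReduced (a ++ b) := by
  induction l₁ using List.reverseRecOn generalizing l₂ with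
  | nil => exact ⟨[], l₂, [], by simp, by simp [FreeGroup.invRev], by simpa using h₂⟩
  | append_singleton l x ih =>
    cases l₂ with
    | nil => exact ⟨l ++ [x], [], [], by simp, by simp [FreeGroup.invRev], by simpa using h₁⟩
    | cons y l₂ =>
      by_cases hy : y = letterInv x
      · obtain ⟨a, b, c, h, h', h''⟩ := ih l₂ (h₁.infix ⟨[], [x], by simp⟩)
          (h₂.infix ⟨[y], [], by simp⟩)
        refine ⟨a, b, c ++ [x], by simp [h], ?_, h''⟩
        rw [h', hy]
        simp [FreeGroup.invRev, letterInv]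
      · refine ⟨l ++ [x], y :: l₂, [], by simp, by simp [FreeGroup.invRev], ?_⟩
        have h3 : FreeGroup.IsReduced ([x] ++ y :: l₂) := by
          rw [List.singleton_append, FreeGroup.isReduced_cons_cons]
          refine ⟨fun h => ?_, h₂⟩
          by_contra hne
          apply hy
          rcases x with ⟨x, bx⟩
          rcases y with ⟨y, b⟩
          simp only at h hne
          subst h
          simp only [letterInv, Prod.mk.injEq, true_and]
          cases b <;> cases bx <;> simp_all
        have := h₁.append_overlap h3 (by simp)
        simpa using this

end Letters

/-! ### A quasimorphism of defect one on a free group -/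

section TurnOrder

variable {Y : Type*} [LinearOrder Y]

/-- The sign of `b - a`. -/
def cmpSign {K : Type*} [LinearOrder K] (a b : K) : ℤ :=
  if a < b then 1 else if b < a then -1 else 0

/-- The turn made in the Cayley tree between two consecutive letters of a word. -/
def turn : Option (Y × Bool) → Option (Y × Bool) → ℤ
  | some x, some y => cmpSign (letterKey (letterInv x)) (letterKey y)
  | _, _ => 0

/-- The total weight of a word: orientations of its letters and turns between them. -/
def wordWeight : List (Y × Bool) → ℤ
  | [] => 0
  | x :: l => (if x.2 then 1 else -1) + turn (some x) l.head? + wordWeight l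

theorem cmpSign_swap {K : Type*} [LinearOrder K] (a b : K) : cmpSign b a = -cmpSign a b := by
  unfold cmpSign
  rcases lt_trichotomy a b with h | h | h
  · simp [h, h.not_gt]
  · simp [h]
  · simp [h, h.not_gt]

theorem cmpSign_congr {K K' : Type*} [LinearOrder K] [LinearOrder K'] {a b : K} {c d : K'}
    (h : a < b ↔ c < d) (h' : b < a ↔ d < c) : cmpSign a b = cmpSign c d := by
  simp only [cmpSign, h, h']

theorem cmpSign_eq_or {K : Type*} [LinearOrder K] {a b : K} (h : a ≠ b) :
    cmpSign a b = 1 ∨ cmpSign a b = -1 := by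
  unfold cmpSign
  rcases lt_or_gt_of_ne h with h | h
  · simp [h]
  · simp [h, h.not_gt]

theorem abs_cmpSign_le {K : Type*} [LinearOrder K] (a b : K) : |cmpSign a b| ≤ 1 := by
  unfold cmpSign
  split_ifs <;> simp

/-- A linear order has no 3-cycle, so the three signs never all agree; when two of the points
coincide the sum vanishes. -/
theorem abs_cmpSign_cycle_le {K : Type*} [LinearOrder K] (a b c : K) :
    |cmpSign a b + cmpSign b c + cmpSign c a| ≤ 1 := by
  unfold cmpSign
  rcases lt_trichotomy a b with h | h | h <;> rcases lt_trichotomy b c with h' | h' | h' <;>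
    rcases lt_trichotomy a c with h'' | h'' | h'' <;>
    (try subst h) <;> (try subst h') <;> (try subst h'') <;>
    simp_all [lt_asymm] <;> grind

theorem turn_none_left (o : Option (Y × Bool)) : turn none o = 0 := by
  cases o <;> rfl

theorem turn_none_right (o : Option (Y × Bool)) : turn o none = 0 := by
  cases o <;> rfl

theorem wordWeight_append (a b : List (Y × Bool)) :
    wordWeight (a ++ b) = wordWeight a + wordWeight b + turn a.getLast? b.head? := by
  induction a with
  | nil => simp [wordWeight, turn_none_left]
  | cons x a ih =>
    cases a with
    | nil => simp [wordWeight, turn_none_right]; ring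
    | cons y a =>
      rw [List.cons_append, wordWeight, ih, List.getLast?_cons_cons]
      simp only [wordWeight, List.cons_append, List.head?_cons]
      ring

theorem turn_map_letterInv (o o' : Option (Y × Bool)) :
    turn (o.map letterInv) (o'.map letterInv) = -turn o' o := by
  rcases o with _ | x <;> rcases o' with _ | y
  · rfl
  · rfl
  · rfl
  · simpa [turn] using cmpSign_swap (letterKey (letterInv y)) (letterKey x)

theorem wordWeight_invRev (l : List (Y × Bool)) :
    wordWeight (FreeGroup.invRev l) = -wordWeight l := by
  induction l with
  | nil => simp [FreeGroup.invRev, wordWeight]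
  | cons x l ih =>
    rw [invRev_cons, wordWeight_append, ih, getLast?_invRev]
    have := turn_map_letterInv l.head? (some x)
    simp only [Option.map_some] at this
    simp only [wordWeight, List.head?_nil, turn_none_right, List.head?_cons, this]
    rcases x with ⟨x, _ | _⟩ <;> simp [letterInv] <;> ring

/-- A reduced word with `n` letters has `n` signs and `n - 1` turns, and each turn is `±1` because
it does not backtrack. -/
theorem odd_wordWeight {l : List (Y × Bool)} (hl : FreeGroup.IsReduced l) (hne : l ≠ []) :
    Odd (wordWeight l) := by
  induction l with
  | nil => exact absurd rfl hne
  | cons x l ih =>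
    have hx : Odd (if x.2 then 1 else -1 : ℤ) := by split_ifs <;> decide
    cases l with
    | nil => simpa [wordWeight, turn] using hx
    | cons y l =>
      rw [FreeGroup.isReduced_cons_cons] at hl
      have h2 := ih hl.2 (by simp)
      rw [wordWeight]
      have h3 : Odd (turn (some x) (y :: l).head?) := by
        have : letterKey (letterInv x) ≠ letterKey y := by
          intro h
          have h := letterKey_injective h
          subst h
          have := hl.1
          simp [letterInv] at this
        simp only [List.head?_cons, turn]
        rcases cmpSign_eq_or this with h | h <;> rw [h] <;> decide
      exact (hx.add_odd h3).add_odd h2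

/-- The weight of an element of a free group. -/
def freeWeight (g : FreeGroup Y) : ℤ := wordWeight g.toWord

theorem freeWeight_one : freeWeight (1 : FreeGroup Y) = 0 := by
  simp [freeWeight, wordWeight]

theorem freeWeight_inv (g : FreeGroup Y) : freeWeight g⁻¹ = -freeWeight g := by
  rw [freeWeight, FreeGroup.toWord_inv, wordWeight_invRev, freeWeight]

theorem freeWeight_ne_zero {g : FreeGroup Y} (hg : g ≠ 1) : freeWeight g ≠ 0 := by
  have := odd_wordWeight (FreeGroup.isReduced_toWord (x := g))
    (by rwa [Ne, FreeGroup.toWord_eq_nil_iff])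
  intro h
  rw [← freeWeight, h] at this
  exact absurd this (by decide)

/-- The paths of `g`, `h` and `g * h` form a tripod in the Cayley tree. The contributions of its
legs cancel, leaving the turns among the three directions at the branch point. -/
theorem abs_freeWeight_mul_le (g h : FreeGroup Y) :
    |freeWeight g + freeWeight h - freeWeight (g * h)| ≤ 1 := by
  obtain ⟨a, b, c, hg, hh, hr⟩ := exists_cancellation g.toWord h.toWord
    FreeGroup.isReduced_toWord FreeGroup.isReduced_toWord
  have hgh : (g * h).toWord = a ++ b := by
    have h1 : g * h = FreeGroup.mk (a ++ b) := by
      rw [← FreeGroup.mk_toWord (x := g), ← FreeGroup.mk_toWord (x := h), hg, hh,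
        ← FreeGroup.mul_mk, ← FreeGroup.mul_mk, ← FreeGroup.mul_mk, ← FreeGroup.inv_mk]
      group
    rw [h1, FreeGroup.toWord_mk, hr.reduce_eq]
  -- The value `none` stands for an empty leg, at which no turn is made.
  have key : ∀ o₁ o₂ o₃ : Option (Y × Bool),
      |turn o₁ o₂ + turn (o₂.map letterInv) o₃ - turn o₁ o₃| ≤ 1 := by
    rintro (_ | x) (_ | y) (_ | z) <;>
      simp only [turn, Option.map_some, Option.map_none, letterInv_letterInv]
    · simp
    · simp
    · simp
    · simpa using abs_cmpSign_le _ _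
    · simp
    · simpa using abs_cmpSign_le _ _
    · simpa using abs_cmpSign_le _ _
    · have := abs_cmpSign_cycle_le (letterKey (letterInv x)) (letterKey y) (letterKey z)
      rwa [cmpSign_swap (letterKey (letterInv x)) (letterKey z), ← sub_eq_add_neg] at this
  have := key a.getLast? c.head? b.head?
  rw [← getLast?_invRev] at this
  rw [freeWeight, freeWeight, freeWeight, hgh, hg, hh, wordWeight_append, wordWeight_append,
    wordWeight_append, wordWeight_invRev]
  convert this using 2
  ring

theorem wordWeight_map {Z : Type*} [LinearOrder Z] {f : Y → Z} (hf : StrictMono f)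
    (l : List (Y × Bool)) :
    wordWeight (l.map fun x => (f x.1, x.2)) = wordWeight l := by
  have hlt : ∀ x y : Y × Bool, letterKey (f x.1, x.2) < letterKey (f y.1, y.2) ↔
      letterKey x < letterKey y := by
    intro x y
    simp [letterKey, Prod.Lex.toLex_lt_toLex, hf.lt_iff_lt]
  induction l with
  | nil => rfl
  | cons x l ih =>
    rw [List.map_cons, wordWeight, ih, wordWeight]
    congr 2
    cases l with
    | nil => simp [turn]
    | cons y l =>
      have h1 := hlt (letterInv x) y
      have h2 := hlt y (letterInv x)
      simp only [letterInv] at h1 h2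
      exact cmpSign_congr h1 h2

/-- The weight sees the alphabet only through comparisons of letters, and an injective relabelling
keeps words reduced. -/
theorem freeWeight_map {Z : Type*} [LinearOrder Z] {f : Y → Z} (hf : StrictMono f)
    (g : FreeGroup Y) : freeWeight (FreeGroup.map f g) = freeWeight g := by
  have h : FreeGroup.IsReduced (g.toWord.map fun x => (f x.1, x.2)) := by
    have := FreeGroup.isReduced_toWord (x := g)
    unfold FreeGroup.IsReduced at this ⊢
    rw [List.isChain_map]
    exact this.imp fun x y hxy h => hxy (hf.injective h)
  have h' : FreeGroup.map f g = FreeGroup.mk (g.toWord.map fun x => (f x.1, x.2)) := by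
    conv_lhs => rw [← FreeGroup.mk_toWord (x := g)]
    rw [FreeGroup.map.mk]
  rw [freeWeight, h', FreeGroup.toWord_mk, h.reduce_eq, wordWeight_map hf, freeWeight]

theorem freeWeight_mul_pos {g h : FreeGroup Y} (hg : 0 < freeWeight g) (hh : 0 < freeWeight h) :
    0 < freeWeight (g * h) := by
  have := (abs_le.1 (abs_freeWeight_mul_le g h)).2
  omega

end TurnOrder

/-! ### Positive cones, and the left-ordering given by the weight -/

theorem isLeftOrdering_of_cone {G : Type*} [Group G] {P : G → Prop} (h_one : ¬ P 1)
    (h_mul : ∀ g h, P g → P h → P (g * h)) (h_tot : ∀ g, g ≠ 1 → P g ∨ P g⁻¹) :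
    IsLeftOrdering fun g h => P (g⁻¹ * h) where
  strictTotal :=
    { trichotomous := by
        intro a b h1 h2
        by_contra hne
        rcases h_tot (a⁻¹ * b) (by rwa [Ne, inv_mul_eq_one]) with h | h
        · exact h1 h
        · exact h2 (by simpa using h)
      irrefl := fun a => by simpa using h_one
      trans := by
        intro a b c h1 h2
        simpa [mul_assoc] using h_mul _ _ h1 h2 }
  mul_left := by
    intro f g h hgh
    simpa [mul_assoc] using hgh

section FreeOrder

variable {Y : Type*} [LinearOrder Y]

theorem isLeftOrdering_freeWeight :
    IsLeftOrdering fun g h : FreeGroup Y => 0 < freeWeight (g⁻¹ * h) :=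
  isLeftOrdering_of_cone (P := fun g : FreeGroup Y => 0 < freeWeight g)
    (by simp [freeWeight_one]) (fun _ _ => freeWeight_mul_pos)
    (fun g hg => by
      rw [freeWeight_inv]
      rcases lt_or_gt_of_ne (freeWeight_ne_zero hg) with h | h
      · right; omega
      · left; omega)

-- Besides ordering free groups, this makes `FreeGroup ℝ` a linearly ordered alphabet, so that
-- `FreeGroup (FreeGroup ℝ)` has a weight too.
open Classical in
noncomputable instance freeGroupLinearOrder : LinearOrder (FreeGroup Y) :=
  haveI := (isLeftOrdering_freeWeight (Y := Y)).strictTotal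
  linearOrderOfSTO fun g h : FreeGroup Y => 0 < freeWeight (g⁻¹ * h)

theorem freeGroup_lt_iff {g h : FreeGroup Y} : g < h ↔ 0 < freeWeight (g⁻¹ * h) := Iff.rfl

theorem strictMono_mul_left_freeGroup (a : FreeGroup Y) : StrictMono fun g => a * g := by
  intro g h hgh
  simpa [freeGroup_lt_iff, mul_assoc] using hgh

end FreeOrder

/-! ### Splitting off the largest generator, and the convex subgroups -/

section Splitting

/-- A group acts on the free group on its underlying set, by left translation of the generators. -/
def shiftAut (A : Type*) [Group A] : A →* MulAut (FreeGroup A) where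
  toFun a := FreeGroup.freeGroupCongr (Equiv.mulLeft a)
  map_one' := by
    ext x
    simp
  map_mul' a b := by
    ext x
    change FreeGroup.map (a * b * ·) x = FreeGroup.map (a * ·) (FreeGroup.map (b * ·) x)
    rw [FreeGroup.map.comp]
    congr 1
    ext y
    simp [mul_assoc]

theorem shiftAut_apply {A : Type*} [Group A] (a : A) (x : FreeGroup A) :
    shiftAut A a x = FreeGroup.map (fun b => a * b) x := rfl

/-- The homomorphism exhibiting the free group as the semidirect product of the free group on the
conjugates of the generator `m` with the free group on the other generators. -/
noncomputable def splitHom (m : ℝ) :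
    FreeGroup ℝ →* FreeGroup (FreeGroup ℝ) ⋊[shiftAut (FreeGroup ℝ)] FreeGroup ℝ :=
  FreeGroup.lift fun r =>
    if r = m then SemidirectProduct.inl (FreeGroup.of 1) else SemidirectProduct.inr (FreeGroup.of r)

/-- The homomorphism restoring an element from its image under `splitHom`. -/
noncomputable def unsplitHom (m : ℝ) :
    FreeGroup (FreeGroup ℝ) ⋊[shiftAut (FreeGroup ℝ)] FreeGroup ℝ →* FreeGroup ℝ :=
  SemidirectProduct.lift (FreeGroup.lift fun a => a * FreeGroup.of m * a⁻¹) (MonoidHom.id _) (by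
    intro g
    ext a
    simp [shiftAut_apply, mul_assoc])

theorem unsplitHom_splitHom (m : ℝ) (g : FreeGroup ℝ) : unsplitHom m (splitHom m g) = g := by
  have : (unsplitHom m).comp (splitHom m) = MonoidHom.id _ := by
    ext r
    by_cases h : r = m <;> simp [splitHom, unsplitHom, h]
  exact DFunLike.congr_fun this g

theorem freeSub_mono {S T : Set ℝ} (h : S ⊆ T) : freeSub S ≤ freeSub T :=
  Subgroup.closure_mono (Set.image_mono h)

theorem of_mem_freeSub {S : Set ℝ} {s : ℝ} (h : s ∈ S) : FreeGroup.of s ∈ freeSub S :=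
  Subgroup.subset_closure ⟨s, h, rfl⟩

theorem splitHom_right_mem {S : Set ℝ} {m : ℝ} {g : FreeGroup ℝ} (hg : g ∈ freeSub S) :
    (splitHom m g).right ∈ freeSub (S \ {m}) := by
  have : freeSub S ≤ (freeSub (S \ {m})).comap (SemidirectProduct.rightHom.comp (splitHom m)) := by
    rw [freeSub, Subgroup.closure_le]
    rintro _ ⟨r, hr, rfl⟩
    by_cases h : r = m
    · simp [splitHom, h, one_mem]
    · simpa [splitHom, h] using of_mem_freeSub (S := S \ {m}) ⟨hr, h⟩
  exact this hg

/-- When the component on the conjugates of `x_m` is trivial, `unsplitHom` recovers `g` from the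
other component, which does not involve `x_m`. -/
theorem mem_freeSub_diff {S : Set ℝ} {m : ℝ} {g : FreeGroup ℝ} (hg : g ∈ freeSub S)
    (h : (splitHom m g).left = 1) : g ∈ freeSub (S \ {m}) := by
  have h1 : splitHom m g = SemidirectProduct.inr (splitHom m g).right := by
    ext <;> simp [h]
  have h2 : g = (splitHom m g).right := by
    conv_lhs => rw [← unsplitHom_splitHom m g, h1]
    simp [unsplitHom]
  rw [h2]
  exact splitHom_right_mem hg

theorem splitHom_left_eq_one {S : Set ℝ} {m : ℝ} (hm : m ∉ S) {g : FreeGroup ℝ}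
    (hg : g ∈ freeSub S) : (splitHom m g).left = 1 := by
  have : splitHom m g = SemidirectProduct.inr g := by
    refine MonoidHom.eqOn_closure (f := splitHom m) (g := SemidirectProduct.inr) ?_ hg
    rintro _ ⟨r, hr, rfl⟩
    have : r ≠ m := fun h => hm (h ▸ hr)
    simp [splitHom, this]
  simp [this]

theorem exists_finset_mem_freeSub (g : FreeGroup ℝ) : ∃ F : Finset ℝ, g ∈ freeSub F := by
  induction g using FreeGroup.induction_on with
  | C1 => exact ⟨∅, one_mem _⟩
  | of x => exact ⟨{x}, of_mem_freeSub (by simp)⟩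
  | inv_of x ih =>
    obtain ⟨F, hF⟩ := ih
    exact ⟨F, inv_mem hF⟩
  | mul x y hx hy =>
    classical
    obtain ⟨F, hF⟩ := hx
    obtain ⟨F', hF'⟩ := hy
    exact ⟨F ∪ F', mul_mem (freeSub_mono (by simp) hF) (freeSub_mono (by simp) hF')⟩

/-- Left translation preserves the order on conjugators. This invariance is what makes positivity
multiplicative across the semidirect product. -/
theorem freeWeight_shiftAut (a : FreeGroup ℝ) (x : FreeGroup (FreeGroup ℝ)) :
    freeWeight (shiftAut _ a x) = freeWeight x :=
  freeWeight_map (strictMono_mul_left_freeGroup a) x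

/-- The largest index of a generator in `g` is `m`, and `g` is positive relative to the order of
the cosets of the subgroup generated by the smaller generators. -/
def IsPosAt (m : ℝ) (g : FreeGroup ℝ) : Prop :=
  g ∈ freeSub (Set.Iic m) ∧ 0 < freeWeight (splitHom m g).left

theorem IsPosAt.mem {m : ℝ} {g : FreeGroup ℝ} (h : IsPosAt m g) {S : Set ℝ}
    (hg : g ∈ freeSub S) : m ∈ S := by
  by_contra hm
  have := h.2
  rw [splitHom_left_eq_one hm hg, freeWeight_one] at this
  exact lt_irrefl _ this

theorem IsPosAt.mul {m m' : ℝ} {g h : FreeGroup ℝ} (hg : IsPosAt m g) (hh : IsPosAt m' h) :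
    IsPosAt (max m m') (g * h) := by
  refine ⟨mul_mem (freeSub_mono (by simp) hg.1) (freeSub_mono (by simp) hh.1), ?_⟩
  rw [map_mul, SemidirectProduct.mul_left]
  rcases lt_trichotomy m m' with hm | hm | hm
  · rw [max_eq_right hm.le, splitHom_left_eq_one (by simpa using hm) hg.1, one_mul,
      freeWeight_shiftAut]
    exact hh.2
  · subst hm
    rw [max_self]
    refine freeWeight_mul_pos hg.2 ?_
    rw [freeWeight_shiftAut]
    exact hh.2
  · rw [max_eq_left hm.le, splitHom_left_eq_one (by simpa using hm) hh.1, map_one, mul_one]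
    exact hg.2

/-- Discard the largest index while its component is trivial; the first nontrivial component has
nonzero weight and decides the sign. -/
theorem exists_isPosAt {g : FreeGroup ℝ} (hg : g ≠ 1) : ∃ m, IsPosAt m g ∨ IsPosAt m g⁻¹ := by
  obtain ⟨F, hF⟩ := exists_finset_mem_freeSub g
  induction F using Finset.induction_on_max with
  | empty => exact absurd (by simpa [freeSub] using hF) hg
  | insert m F hm ih =>
    by_cases h : (splitHom m g).left = 1
    · refine ih (freeSub_mono ?_ (mem_freeSub_diff hF h))
      intro x
      simp only [Finset.coe_insert, Set.mem_sdiff, Set.mem_insert_iff, Set.mem_singleton_iff]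
      tauto
    · have h1 : g ∈ freeSub (Set.Iic m) := by
        refine freeSub_mono ?_ hF
        intro x hx
        rcases Finset.mem_insert.1 (Finset.mem_coe.1 hx) with rfl | hx
        · exact Set.self_mem_Iic
        · exact (hm x hx).le
      refine ⟨m, (lt_or_gt_of_ne (freeWeight_ne_zero h)).symm.imp (fun h' => ⟨h1, h'⟩)
        fun h' => ⟨inv_mem h1, ?_⟩⟩
      rw [map_inv, SemidirectProduct.inv_left, freeWeight_shiftAut, freeWeight_inv]
      exact neg_pos.2 h'

theorem exists_isInitiallyConvexOrdering :
    ∃ lt : FreeGroup ℝ → FreeGroup ℝ → Prop, IsInitiallyConvexOrdering lt := by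
  refine ⟨fun g h => ∃ m, IsPosAt m (g⁻¹ * h), ?_, ?_⟩
  · refine isLeftOrdering_of_cone (P := fun g => ∃ m, IsPosAt m g) ?_ ?_ ?_
    · rintro ⟨m, hm⟩
      exact hm.mem (S := ∅) (one_mem _)
    · rintro g h ⟨m, hm⟩ ⟨m', hm'⟩
      exact ⟨_, hm.mul hm'⟩
    · intro g hg
      obtain ⟨m, hm⟩ := exists_isPosAt hg
      exact hm.imp (⟨m, ·⟩) (⟨m, ·⟩)
  · rintro S hS a ha b hb g ⟨m, hm⟩ ⟨m', hm'⟩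
    have hsub : ∀ x ∈ S, Set.Iic x ⊆ S := fun x hx y hy => by
      rcases (Set.mem_Iic.1 hy).lt_or_eq with h | rfl
      · exact hS x y hx h
      · exact hx
    -- The product of `a⁻¹ * g` and `g⁻¹ * b` lies in `F(X_S)`, so `max m m'` is in `S`. The factor
    -- attaining the maximum then lies in `F(X_S)` as well.
    have h := (hm.mul hm').mem (S := S) (by
      simpa [mul_assoc] using mul_mem (inv_mem ha) hb)
    rcases max_choice m m' with h' | h' <;> rw [h'] at h
    · simpa using mul_mem ha (freeSub_mono (hsub _ h) hm.1)
    · simpa using mul_mem hb (inv_mem (freeSub_mono (hsub _ h) hm'.1))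

end Splitting

/-! ### Unnaturality on the line -/

/-- In a monotone family of nonempty subsets of a well-ordered set, indexed by the reals, the
least element is the same for some two of the sets. -/
theorem exists_common_min {Ω : Type*} (r : Ω → Ω → Prop) [IsWellOrder Ω r] (M : ℝ → Set Ω)
    (hne : ∀ s, (M s).Nonempty) :
    ∃ a b : ℝ, a < b ∧ ∃ x ∈ M a, ∀ y, r y x → y ∉ M b := by
  by_contra! hcon
  have wf : WellFounded r := IsWellFounded.wf
  have hdesc : ∀ a b, a < b → r (wf.min (M b) (hne b)) (wf.min (M a) (hne a)) := by
    intro a b hab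
    obtain ⟨y, hy, hyb⟩ := hcon a b hab _ (wf.min_mem (M a) (hne a))
    have h := wf.not_lt_min (M b) hyb
    rcases trichotomous_of r (wf.min (M b) (hne b)) y with h' | h' | h'
    · exact trans_of r h' hy
    · rwa [h']
    · exact absurd h' h
  -- Otherwise the least elements at the indices 0, 1, 2, … would descend forever.
  refine (wellFounded_iff_isEmpty_descending_chain.1 wf).false
    ⟨fun n : ℕ => wf.min (M n) (hne n), fun n => hdesc _ _ (by simp)⟩

theorem exists_lt_eq_of_countable {K : Type*} [Countable K] {a b : ℝ} (hab : a < b) (q : ℝ → K) :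
    ∃ s s', a < s ∧ s < s' ∧ s' < b ∧ q s = q s' := by
  by_contra! hcon
  have hinj : Function.Injective fun s : Set.Ioo a b => q s := by
    rintro ⟨s, hs⟩ ⟨s', hs'⟩ h
    rcases lt_trichotomy s s' with h' | h' | h'
    · exact absurd h (hcon s s' hs.1 h' hs'.2)
    · exact Subtype.ext h'
    · exact absurd h.symm (hcon s' s hs'.1 h' hs.2)
  have hc : (Set.Ioo a b).Countable := hinj.countable
  have := hc.le_aleph0
  rw [Cardinal.mk_Ioo_real hab] at this
  exact absurd this (not_le.2 Cardinal.aleph0_lt_continuum)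

theorem mem_freeSub_iff_of {S : Set ℝ} {s : ℝ} : FreeGroup.of s ∈ freeSub S ↔ s ∈ S := by
  refine ⟨fun h => ?_, of_mem_freeSub⟩
  by_contra hs
  have := splitHom_left_eq_one hs h
  simp [splitHom] at this

theorem exists_moved {H Ω : Type*} [Group H] (ρ : FreeGroup ℝ →* H) (hρ : Function.Injective ρ)
    (v : H → Ω → Ω) (hv : ∀ h, (∀ y, v h y = y) → h = 1) (s : ℝ) :
    {y | ∃ c ∈ freeSub (Set.Iio s), v (ρ c) y ≠ y}.Nonempty := by
  by_contra hcon
  rw [Set.not_nonempty_iff_eq_empty] at hcon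
  have h1 : ρ (FreeGroup.of (s - 1)) = 1 := by
    refine hv _ fun y => ?_
    by_contra hy
    have : y ∈ {y | ∃ c ∈ freeSub (Set.Iio s), v (ρ c) y ≠ y} :=
      ⟨_, of_mem_freeSub (by simp), hy⟩
    rw [hcon] at this
    exact this
  exact FreeGroup.of_ne_one _ (hρ (h1.trans (map_one ρ).symm))

theorem isConvex_freeSub_Iio {lt : FreeGroup ℝ → FreeGroup ℝ → Prop}
    (h : IsInitiallyConvexOrdering lt) (s : ℝ) : IsConvex lt (freeSub (Set.Iio s)) :=
  h.2 _ fun _ _ hx hy => hy.trans hx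

theorem homeoPlusReal_mul_apply (f g : HomeoPlusReal) (x : ℝ) : (f * g).1 x = f.1 (g.1 x) := rfl

theorem homeoPlusReal_apply_inv (f : HomeoPlusReal) (x : ℝ) : f.1 (f⁻¹.1 x) = x :=
  f.1.apply_symm_apply x

theorem IsInitiallyConvexOrdering.not_isNatural {lt : FreeGroup ℝ → FreeGroup ℝ → Prop}
    (hlt : IsInitiallyConvexOrdering lt) : ¬ IsNatural lt := by
  rintro ⟨r, hr, ρ, hρ, h⟩
  have := hlt.1.strictTotal
  obtain ⟨a, b, hab, x, ⟨c, hc, hcx⟩, hx⟩ := exists_common_min r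
    (fun s => {y | ∃ c ∈ freeSub (Set.Iio s), (ρ c).1 y ≠ y})
    (exists_moved ρ hρ (fun f => f.1) fun f hf => Subtype.ext (Homeomorph.ext hf))
  have hfix : ∀ f ∈ freeSub (Set.Iio b), ∀ y, r y x → (ρ f).1 y = y := by
    intro f hf y hy
    by_contra hne
    exact hx y hy ⟨f, hf, hne⟩
  -- No point before `x` is moved by `F(X_{<b})`, so the images of `x`, when distinct, decide the
  -- order there.
  have hlt_of : ∀ f ∈ freeSub (Set.Iio b), ∀ g ∈ freeSub (Set.Iio b),
      (ρ f).1 x < (ρ g).1 x → lt f g := by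
    intro f hf g hg hfg
    rw [h]
    have h1 : x < ((ρ f)⁻¹ * ρ g).1 x := by
      rw [homeoPlusReal_mul_apply, ← (ρ f).2, homeoPlusReal_apply_inv]
      exact hfg
    refine ⟨x, h1.ne', fun y hy => ?_, h1⟩
    rw [← map_inv, ← map_mul]
    exact hfix _ (mul_mem (inv_mem hf) hg) y hy
  obtain ⟨c, hc, hcx⟩ : ∃ c ∈ freeSub (Set.Iio a), x < (ρ c).1 x := by
    rcases lt_or_gt_of_ne hcx with h' | h'
    · refine ⟨c⁻¹, inv_mem hc, ?_⟩
      rw [map_inv, ← (ρ c).2, homeoPlusReal_apply_inv]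
      exact h'
    · exact ⟨c, hc, h'⟩
  have hq : ∀ s : ℝ, ∃ q : ℚ, (ρ (FreeGroup.of s)).1 x < q ∧
      (q : ℝ) < (ρ (FreeGroup.of s * c)).1 x := by
    intro s
    apply exists_rat_btwn
    rw [map_mul, homeoPlusReal_mul_apply]
    exact ((ρ (FreeGroup.of s)).2 _ _).2 hcx
  choose q hq1 hq2 using hq
  obtain ⟨s, s', has, hss, hsb, hqq⟩ := exists_lt_eq_of_countable hab q
  have hcb : c ∈ freeSub (Set.Iio b) := freeSub_mono (Set.Iio_subset_Iio hab.le) hc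
  have hcs : c ∈ freeSub (Set.Iio s') := freeSub_mono (Set.Iio_subset_Iio (by linarith)) hc
  have hu : FreeGroup.of s ∈ freeSub (Set.Iio s') := of_mem_freeSub hss
  have hub : FreeGroup.of s ∈ freeSub (Set.Iio b) := of_mem_freeSub (hss.trans hsb)
  have hgb : FreeGroup.of s' ∈ freeSub (Set.Iio b) := of_mem_freeSub hsb
  have hg : FreeGroup.of s' ∉ freeSub (Set.Iio s') := by simp [mem_freeSub_iff_of]
  have h1 : lt (FreeGroup.of s') (FreeGroup.of s * c) :=
    hlt_of _ hgb _ (mul_mem hub hcb) ((hq1 s').trans (hqq ▸ hq2 s))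
  have h2 : lt (FreeGroup.of s) (FreeGroup.of s' * c) :=
    hlt_of _ hub _ (mul_mem hgb hcb) ((hq1 s).trans (hqq ▸ hq2 s'))
  have hconv := isConvex_freeSub_Iio hlt s'
  -- Either `x_{s'}` lies between `x_s` and `x_s c`, or `x_{s'}⁻¹ x_s` lies between 1 and `c`. Both
  -- force `x_{s'}` into `F(X_{<s'})`.
  rcases trichotomous_of lt (FreeGroup.of s) (FreeGroup.of s') with h3 | h3 | h3
  · exact hg (hconv _ hu _ (mul_mem hu hcs) _ h3 h1)
  · exact hg (h3 ▸ hu)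
  · have h4 := hlt.1.mul_left (FreeGroup.of s')⁻¹ _ _ h3
    have h5 := hlt.1.mul_left (FreeGroup.of s')⁻¹ _ _ h2
    rw [inv_mul_cancel] at h4
    rw [inv_mul_cancel_left] at h5
    have h6 := hconv _ (one_mem _) _ hcs _ h4 h5
    exact hg (inv_mem_iff.1 (by simpa using mul_mem h6 (inv_mem hu)))

/-! ### Circular orderings induced by left-orderings -/

section CyclicOrder

/-- The cyclic orientation of triples induced by a linear order. -/
def IsCyclicTriple {G : Type*} (lt : G → G → Prop) (f g h : G) : Prop :=
  (lt f g ∧ lt g h) ∨ (lt g h ∧ lt h f) ∨ (lt h f ∧ lt f g)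

open Classical in
/-- The circular ordering induced by a linear order. -/
noncomputable def cyclicOrder {G : Type*} (lt : G → G → Prop) (f g h : G) : SignType :=
  if IsCyclicTriple lt f g h then 1 else if IsCyclicTriple lt h g f then -1 else 0

theorem cyclicOrder_eq_one_iff {G : Type*} {lt : G → G → Prop} {f g h : G} :
    cyclicOrder lt f g h = 1 ↔ IsCyclicTriple lt f g h := by
  unfold cyclicOrder
  split_ifs <;> simp_all

theorem stdCircular_eq_one_iff {r : S1 → S1 → Prop} {p : S1} {f g h : HomeoPlusCircle} :
    stdCircular r p f g h = 1 ↔ stdPosTriple r p f g h := by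
  unfold stdCircular
  split_ifs <;> simp_all

theorem coe_cyclicOrder {G : Type*} [LinearOrder G] (f g h : G) :
    (cyclicOrder (fun a b : G => a < b) f g h : ℤ) =
      cmpSign f g + cmpSign g h + cmpSign h f := by
  unfold cyclicOrder IsCyclicTriple cmpSign
  rcases lt_trichotomy f g with h₁ | h₁ | h₁ <;> rcases lt_trichotomy g h with h₂ | h₂ | h₂ <;>
    rcases lt_trichotomy f h with h₃ | h₃ | h₃ <;>
    first
    | (exfalso; order)
    | simp [h₁, h₂, h₃, not_lt_of_gt]

theorem isCircularOrdering_cyclicOrder {G : Type*} [Group G] {lt : G → G → Prop}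
    (hlt : IsLeftOrdering lt) : IsCircularOrdering (cyclicOrder lt) := by
  classical
  have := hlt.strictTotal
  let _ : LinearOrder G := linearOrderOfSTO lt
  have hc : ∀ f g h : G, (cyclicOrder lt f g h : ℤ) = cmpSign f g + cmpSign g h + cmpSign h f :=
    coe_cyclicOrder
  refine ⟨fun f g h => ?_, fun a b c d => ?_, fun k f g h => ?_⟩
  · have h0 : cyclicOrder lt f g h = 0 ↔ (cyclicOrder lt f g h : ℤ) = 0 := by
      cases cyclicOrder lt f g h <;> simp
    rw [h0, hc]
    unfold cmpSign
    rcases lt_trichotomy f g with h₁ | h₁ | h₁ <;> rcases lt_trichotomy g h with h₂ | h₂ | h₂ <;>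
      rcases lt_trichotomy f h with h₃ | h₃ | h₃ <;>
      first
      | (exfalso; order)
      | simp [h₁, h₂, h₃, not_lt_of_gt, ne_of_lt, ne_of_gt]
  · simp only [hc]
    rw [cmpSign_swap a c, cmpSign_swap b d]
    ring
  · have hk : ∀ x y, lt (k * x) (k * y) ↔ lt x y := fun x y =>
      ⟨fun h => by simpa using hlt.mul_left k⁻¹ _ _ h, hlt.mul_left k x y⟩
    have h3 : ∀ x y z, IsCyclicTriple lt (k * x) (k * y) (k * z) = IsCyclicTriple lt x y z := by
      simp only [IsCyclicTriple, hk, implies_true]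
    unfold cyclicOrder
    rw [h3, h3]

end CyclicOrder

/-! ### Arcs of the circle -/

section Circle

theorem sbtw_of_sbtw_of_sbtw {α : Type*} [CircularOrder α] {z a b c : α} (h : sbtw z a b)
    (h' : sbtw z b c) : sbtw a b c :=
  (h'.cyclic_right.trans_left h).cyclic_left

theorem sbtw_or_sbtw {α : Type*} [CircularOrder α] {a b c : α} (hab : a ≠ b) (hbc : b ≠ c)
    (hca : c ≠ a) : sbtw a b c ∨ sbtw c b a := by
  by_contra! h
  rw [← btw_iff_not_sbtw, ← btw_iff_not_sbtw] at h
  rcases h.1.antisymm h.2 with h | h | h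
  · exact hbc h.symm
  · exact hab h.symm
  · exact hca h.symm

theorem SBtw.ne_left {α : Type*} [CircularOrder α] {a b c : α} (h : sbtw a b c) : a ≠ b := by
  rintro rfl
  exact sbtw_irrefl_left h

theorem SBtw.ne_left_right {α : Type*} [CircularOrder α] {a b c : α} (h : sbtw a b c) :
    a ≠ c := by
  rintro rfl
  exact sbtw_irrefl_left_right h

/-- Going backwards from the common point `z`, whichever of the distinct initial points `u`, `g` is
met first lies inside the other arc, which `h₁` and `h₂` exclude. -/
theorem arcs_disjoint {α : Type*} [CircularOrder α] {u v g k z : α} (huv : sbtw u z v)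
    (hgk : sbtw g z k) (h₁ : btw u v g) (h₂ : btw u g k) (hne : g ≠ u) : False := by
  rcases sbtw_or_sbtw (SBtw.ne_left hgk).symm hne (SBtw.ne_left huv) with h | h
  · exact not_btw_of_sbtw (sbtw_of_sbtw_of_sbtw hgk.cyclic_left h) h₂
  · have h3 := sbtw_of_sbtw_of_sbtw huv.cyclic_left h.cyclic_right
    exact not_btw_of_sbtw h3 h₁.cyclic_left.cyclic_left

theorem exists_coe_mem_Ico (a : ℝ) (x : S1) : ∃ b ∈ Set.Ico a (a + 1), (b : S1) = x := by
  have h := (AddCircle.equivIco 1 a x).2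
  exact ⟨_, h, (AddCircle.equivIco 1 a).symm_apply_apply x⟩

theorem exists_coe_mem_Ioc (a : ℝ) (x : S1) : ∃ b ∈ Set.Ioc a (a + 1), (b : S1) = x := by
  have h := (AddCircle.equivIoc 1 a x).2
  exact ⟨_, h, (AddCircle.equivIoc 1 a).symm_apply_apply x⟩

/-- The opposite half-open intervals handle degenerate triples: `b` equal to `a` on the circle means
`b = a + 1`, and `c` equal to `a` means `c = a`, so `b < c` fails. -/
theorem sbtw_coe_iff {a b c : ℝ} (hb : b ∈ Set.Ioc a (a + 1)) (hc : c ∈ Set.Ico a (a + 1)) :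
    sbtw (a : S1) (b : S1) (c : S1) ↔ b < c := by
  rw [sbtw_iff_not_btw, btw_cyclic, QuotientAddGroup.btw_coe_iff, not_le,
    (toIocMod_eq_self _).2 hb, (toIcoMod_eq_self _).2 hc]

theorem exists_rat_sbtw {x y : S1} (h : x ≠ y) : ∃ q : ℚ, sbtw x ((q : ℝ) : S1) y := by
  obtain ⟨a, -, rfl⟩ := exists_coe_mem_Ico 0 x
  obtain ⟨b, hb, rfl⟩ := exists_coe_mem_Ico a y
  have hab : a < b := lt_of_le_of_ne hb.1 fun h' => h (by rw [h'])
  obtain ⟨q, hq, hq'⟩ := exists_rat_btwn hab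
  exact ⟨q, (sbtw_coe_iff ⟨hq, (hq'.trans hb.2).le⟩ hb).2 hq'⟩

end Circle

/-! ### Unnaturality on the circle -/

section Unnatural

theorem homeoPlusCircle_mul_apply (f g : HomeoPlusCircle) (x : S1) :
    (f * g).1 x = f.1 (g.1 x) := rfl

theorem homeoPlusCircle_inv_apply (f : HomeoPlusCircle) (x : S1) : f⁻¹.1 (f.1 x) = x :=
  f.1.symm_apply_apply x

theorem homeoPlusCircle_apply_inv (f : HomeoPlusCircle) (x : S1) : f.1 (f⁻¹.1 x) = x :=
  f.1.apply_symm_apply x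

variable {r : S1 → S1 → Prop} {p : S1}

/-- `f⁻¹ g` and its inverse have the same least moved point and move it in opposite directions. -/
theorem cosetLT_asymm [IsWellOrder S1 r] {f g : HomeoPlusCircle} (h : cosetLT r p f g) :
    ¬ cosetLT r p g f := by
  rintro ⟨-, x', hx', hx'r, hx'p⟩
  obtain ⟨hp, x, hx, hxr, hxp⟩ := h
  rw [homeoPlusCircle_mul_apply] at hx hxp hx' hx'p
  simp only [homeoPlusCircle_mul_apply] at hxr hx'r
  have hiff : ∀ y, f⁻¹.1 (g.1 y) = y ↔ g⁻¹.1 (f.1 y) = y := by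
    intro y
    constructor
    · intro h
      nth_rw 1 [← h]
      rw [homeoPlusCircle_apply_inv, homeoPlusCircle_inv_apply]
    · intro h
      nth_rw 1 [← h]
      rw [homeoPlusCircle_apply_inv, homeoPlusCircle_inv_apply]
  rcases trichotomous_of r x x' with h | h | h
  · exact hx ((hiff x).2 (hx'r x h))
  · subst h
    rw [← f.2, homeoPlusCircle_apply_inv] at hxp
    rw [← g.2, homeoPlusCircle_apply_inv, ← hp] at hx'p
    exact sbtw_asymm hxp hx'p.cyclic_left
  · exact hx' ((hiff x').1 (hxr x' h))

theorem eq_or_sbtw_of_cosetLT [IsWellOrder S1 r] {x : S1} (hpx : r p x) {f g : HomeoPlusCircle}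
    (hf : ∀ y, r y x → f.1 y = y) (hg : ∀ y, r y x → g.1 y = y) (h : cosetLT r p f g) :
    f.1 x = g.1 x ∨ sbtw p (f.1 x) (g.1 x) := by
  obtain ⟨-, y, hy, hyr, hyp⟩ := h
  rw [homeoPlusCircle_mul_apply] at hy hyp
  simp only [homeoPlusCircle_mul_apply] at hyr
  rcases trichotomous_of r y x with h | h | h
  · refine absurd ?_ hy
    rw [hg y h]
    nth_rw 1 [← hf y h]
    exact homeoPlusCircle_inv_apply f y
  · subst h
    right
    rwa [← f.2, homeoPlusCircle_apply_inv, hf p hpx] at hyp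
  · left
    rw [← hyr x h, homeoPlusCircle_apply_inv]
    exact congrArg _ (hyr x h).symm

/-- Evaluation at `x` is weakly monotone for the circular ordering: either `x = p`, or all three
maps fix `p` and are compared linearly on the complement. The second conclusion treats the tie left
open by weak monotonicity. -/
theorem btw_and_cosetLT_of_stdPosTriple [IsWellOrder S1 r] (hp : ∀ y, ¬ r y p) {x : S1}
    {f g h : HomeoPlusCircle} (hf : ∀ y, r y x → f.1 y = y) (hg : ∀ y, r y x → g.1 y = y)
    (hh : ∀ y, r y x → h.1 y = y) (hpos : stdPosTriple r p f g h) :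
    btw (f.1 x) (g.1 x) (h.1 x) ∧ (f.1 x = h.1 x → f.1 x ≠ g.1 x → cosetLT r p h f) := by
  rcases trichotomous_of r p x with hpx | rfl | hxp
  · have key : ∀ {f g h : HomeoPlusCircle}, (∀ y, r y x → f.1 y = y) → (∀ y, r y x → g.1 y = y) →
        (∀ y, r y x → h.1 y = y) → cosetLT r p f g → cosetLT r p g h →
        btw (f.1 x) (g.1 x) (h.1 x) ∧ (f.1 x = h.1 x → f.1 x = g.1 x) := by
      intro f g h hf hg hh h1 h2
      rcases eq_or_sbtw_of_cosetLT hpx hf hg h1 with h3 | h3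
      · rw [h3]
        exact ⟨btw_refl_left _ _, fun _ => rfl⟩
      · rcases eq_or_sbtw_of_cosetLT hpx hg hh h2 with h4 | h4
        · rw [h4]
          exact ⟨btw_refl_right _ _, fun h => h⟩
        · have h5 := sbtw_of_sbtw_of_sbtw h3 h4
          exact ⟨h5.btw, fun h => absurd h (SBtw.ne_left_right h5)⟩
    have hfp := hf p hpx
    have hgp := hg p hpx
    have hhp := hh p hpx
    rcases hpos with h1 | ⟨-, h1⟩ | ⟨-, h1⟩ | ⟨-, h1⟩ | ⟨h1, h2⟩ | ⟨h1, h2⟩ | ⟨h1, h2⟩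
    · rw [hfp, hgp, hhp] at h1
      exact absurd h1 (sbtw_irrefl _)
    · exact absurd (hhp.trans hfp.symm) h1
    · exact absurd (hfp.trans hgp.symm) h1
    · exact absurd (hgp.trans hhp.symm) h1
    · have h3 := key hf hg hh h1 h2
      exact ⟨h3.1, fun h4 h5 => absurd (h3.2 h4) h5⟩
    · exact ⟨(key hg hh hf h1 h2).1.cyclic_left.cyclic_left, fun _ _ => h2⟩
    · exact ⟨(key hh hf hg h1 h2).1.cyclic_left, fun _ _ => h1⟩
  · rcases hpos with h1 | ⟨h1, h2⟩ | ⟨h1, h2⟩ | ⟨h1, h2⟩ | ⟨h1, h2⟩ | ⟨h1, h2⟩ | ⟨h1, h2⟩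
    · exact ⟨h1.btw, fun h => absurd h (SBtw.ne_left_right h1)⟩
    · rw [h1.1]
      exact ⟨btw_refl_left _ _, fun _ h => absurd rfl h⟩
    · rw [h1.1]
      exact ⟨btw_refl_right _ _, fun h h' => absurd h h'⟩
    · rw [h1.1]
      exact ⟨btw_refl_left_right _ _, fun _ _ => h1⟩
    · rw [h1.1]
      exact ⟨btw_refl_left _ _, fun _ h => absurd rfl h⟩
    · rw [h1.1]
      exact ⟨btw_refl_right _ _, fun h h' => absurd h h'⟩
    · rw [h1.1]
      exact ⟨btw_refl_left_right _ _, fun _ _ => h1⟩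
  · exact absurd hxp (hp x)

theorem IsInitiallyConvexOrdering.not_isNaturalCircular
    {lt : FreeGroup ℝ → FreeGroup ℝ → Prop} (hlt : IsInitiallyConvexOrdering lt) :
    ¬ IsNaturalCircular (cyclicOrder lt) := by
  rintro ⟨r, hr, p, hp, ρ, hρ, h⟩
  have := hlt.1.strictTotal
  have hpos : ∀ f g h, IsCyclicTriple lt f g h → stdPosTriple r p (ρ f) (ρ g) (ρ h) := by
    intro f g k hc
    rwa [← stdCircular_eq_one_iff, ← h, cyclicOrder_eq_one_iff]
  obtain ⟨a, b, hab, x, ⟨c, hc, hcx⟩, hx⟩ := exists_common_min r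
    (fun s => {y | ∃ c ∈ freeSub (Set.Iio s), (ρ c).1 y ≠ y})
    (exists_moved ρ hρ (fun f => f.1) fun f hf => Subtype.ext (Homeomorph.ext hf))
  have hfix : ∀ f ∈ freeSub (Set.Iio b), ∀ y, r y x → (ρ f).1 y = y := by
    intro f hf y hy
    by_contra hne
    exact hx y hy ⟨f, hf, hne⟩
  obtain ⟨c, hc, hcx, hc1⟩ : ∃ c ∈ freeSub (Set.Iio a), (ρ c).1 x ≠ x ∧ lt 1 c := by
    rcases trichotomous_of lt 1 c with h' | h' | h'
    · exact ⟨c, hc, hcx, h'⟩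
    · subst h'
      simp at hcx
    · refine ⟨c⁻¹, inv_mem hc, fun h => hcx ?_, by simpa using hlt.1.mul_left c⁻¹ _ _ h'⟩
      nth_rw 1 [← h]
      rw [map_inv, homeoPlusCircle_apply_inv]
  have hq : ∀ s : ℝ, ∃ q : ℚ, sbtw ((ρ (FreeGroup.of s)).1 x) ((q : ℝ) : S1)
      ((ρ (FreeGroup.of s * c)).1 x) := by
    intro s
    apply exists_rat_sbtw
    rw [map_mul, homeoPlusCircle_mul_apply]
    exact fun h => hcx ((ρ (FreeGroup.of s)).1.injective h).symm
  choose q hq using hq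
  obtain ⟨s, s', has, hss, hsb, hqq⟩ := exists_lt_eq_of_countable hab q
  have hcb : c ∈ freeSub (Set.Iio b) := freeSub_mono (Set.Iio_subset_Iio hab.le) hc
  have hcs : c ∈ freeSub (Set.Iio s') := freeSub_mono (Set.Iio_subset_Iio (by linarith)) hc
  have hu : FreeGroup.of s ∈ freeSub (Set.Iio s') := of_mem_freeSub hss
  have hub : FreeGroup.of s ∈ freeSub (Set.Iio b) := of_mem_freeSub (hss.trans hsb)
  have hgb : FreeGroup.of s' ∈ freeSub (Set.Iio b) := of_mem_freeSub hsb
  have hg : FreeGroup.of s' ∉ freeSub (Set.Iio s') := by simp [mem_freeSub_iff_of]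
  have hgc : FreeGroup.of s' * c ∉ freeSub (Set.Iio s') := fun h' =>
    hg ((Subgroup.mul_mem_cancel_right _ hcs).1 h')
  have hconv := isConvex_freeSub_Iio hlt s'
  have huv : lt (FreeGroup.of s) (FreeGroup.of s * c) := by
    simpa using hlt.1.mul_left (FreeGroup.of s) _ _ hc1
  have hgk : lt (FreeGroup.of s') (FreeGroup.of s' * c) := by
    simpa using hlt.1.mul_left (FreeGroup.of s') _ _ hc1
  -- By convexity neither pair `x_s`, `x_s c` nor `x_{s'}`, `x_{s'} c` is separated by the initial
  -- element of the other.
  have hcyc : IsCyclicTriple lt (FreeGroup.of s) (FreeGroup.of s * c) (FreeGroup.of s') ∧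
      IsCyclicTriple lt (FreeGroup.of s') (FreeGroup.of s' * c) (FreeGroup.of s) := by
    rcases trichotomous_of lt (FreeGroup.of s') (FreeGroup.of s) with h3 | h3 | h3
    · refine ⟨Or.inr (Or.inr ⟨h3, huv⟩), Or.inl ⟨hgk, ?_⟩⟩
      rcases trichotomous_of lt (FreeGroup.of s' * c) (FreeGroup.of s) with h4 | h4 | h4
      · exact h4
      · exact absurd (h4 ▸ hu) hgc
      · have h5 := hlt.1.mul_left (FreeGroup.of s')⁻¹ _ _ h3
        have h6 := hlt.1.mul_left (FreeGroup.of s')⁻¹ _ _ h4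
        rw [inv_mul_cancel] at h5
        rw [inv_mul_cancel_left] at h6
        have h7 := hconv _ (one_mem _) _ hcs _ h5 h6
        exact absurd (inv_mem_iff.1 ((Subgroup.mul_mem_cancel_right _ hu).1 h7)) hg
    · exact absurd (h3 ▸ hu) hg
    · refine ⟨Or.inl ⟨huv, ?_⟩, Or.inr (Or.inr ⟨h3, hgk⟩)⟩
      rcases trichotomous_of lt (FreeGroup.of s * c) (FreeGroup.of s') with h4 | h4 | h4
      · exact h4
      · exact absurd (h4 ▸ mul_mem hu hcs) hg
      · exact absurd (hconv _ hu _ (mul_mem hu hcs) _ h3 h4) hg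
  have h1 := btw_and_cosetLT_of_stdPosTriple hp (hfix _ hub) (hfix _ (mul_mem hub hcb))
    (hfix _ hgb) (hpos _ _ _ hcyc.1)
  have h2 := btw_and_cosetLT_of_stdPosTriple hp (hfix _ hgb) (hfix _ (mul_mem hgb hcb))
    (hfix _ hub) (hpos _ _ _ hcyc.2)
  -- The arcs share the point `q s`, so their initial points must coincide; the tie clauses then
  -- order `x_s` and `x_{s'}` both ways.
  refine arcs_disjoint (hq s) (hqq ▸ hq s') h1.1 h2.1.cyclic_left.cyclic_left fun heq => ?_
  exact cosetLT_asymm (h1.2 heq.symm (SBtw.ne_left_right (hq s)))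
    (h2.2 heq (SBtw.ne_left_right (hq s')))

end Unnatural

/-! ### Extending order automorphisms from the rationals to the line -/

/-- An action of a group by strictly monotone maps, as a homomorphism to the group of order
automorphisms. -/
def orderAutHom {G Ω : Type*} [Group G] [LinearOrder Ω] (v : G → Ω → Ω) (h_one : ∀ x, v 1 x = x)
    (h_mul : ∀ g h x, v (g * h) x = v g (v h x)) (h_mono : ∀ g, StrictMono (v g)) :
    G →* (Ω ≃o Ω) where
  toFun g :=
    { toFun := v g
      invFun := v g⁻¹
      left_inv := fun x => by rw [← h_mul, inv_mul_cancel, h_one]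
      right_inv := fun x => by rw [← h_mul, mul_inv_cancel, h_one]
      map_rel_iff' := (h_mono g).le_iff_le }
  map_one' := by
    ext x
    exact h_one x
  map_mul' g h := by
    ext x
    exact h_mul g h x

section Completion

/-- The extension of an order automorphism of `ℚ` to `ℝ`. -/
noncomputable def realExtension (f : ℚ ≃o ℚ) (x : ℝ) : ℝ :=
  sSup ((fun q : ℚ => (f q : ℝ)) '' {q : ℚ | (q : ℝ) < x})

/-- This describes the Dedekind cut of the extended value, which reduces identities between
extensions to comparisons of rationals. -/
theorem lt_realExtension_iff (f : ℚ ≃o ℚ) (x : ℝ) (q : ℚ) :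
    (f q : ℝ) < realExtension f x ↔ (q : ℝ) < x := by
  have hne : ((fun q : ℚ => (f q : ℝ)) '' {q : ℚ | (q : ℝ) < x}).Nonempty := by
    obtain ⟨q, hq⟩ := exists_rat_lt x
    exact ⟨_, q, hq, rfl⟩
  have hbdd : BddAbove ((fun q : ℚ => (f q : ℝ)) '' {q : ℚ | (q : ℝ) < x}) := by
    obtain ⟨q, hq⟩ := exists_rat_gt x
    refine ⟨f q, ?_⟩
    rintro _ ⟨q', hq', rfl⟩
    have hq' : (q' : ℝ) < x := hq'
    have h : q' < q := by exact_mod_cast hq'.trans hq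
    have h' : (f q' : ℝ) ≤ f q := by exact_mod_cast (f.lt_iff_lt.2 h).le
    exact h'
  constructor
  · intro h
    obtain ⟨_, ⟨q', hq', rfl⟩, h⟩ := exists_lt_of_lt_csSup hne h
    have h : (f q : ℝ) < f q' := h
    have h : f q < f q' := by exact_mod_cast h
    have h : (q : ℝ) < q' := by exact_mod_cast f.lt_iff_lt.1 h
    exact h.trans hq'
  · intro h
    obtain ⟨q', hq, hq'⟩ := exists_rat_btwn h
    have hq : q < q' := by exact_mod_cast hq
    have h1 : (f q : ℝ) < f q' := by exact_mod_cast f.lt_iff_lt.2 hq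
    exact h1.trans_le (le_csSup hbdd ⟨q', hq', rfl⟩)

theorem le_of_forall_rat_lt {x y : ℝ} (h : ∀ q : ℚ, (q : ℝ) < x → (q : ℝ) < y) : x ≤ y := by
  by_contra! hxy
  obtain ⟨q, h1, h2⟩ := exists_rat_btwn hxy
  exact lt_asymm h1 (h q h2)

theorem eq_of_forall_rat_lt_iff {x y : ℝ} (h : ∀ q : ℚ, (q : ℝ) < x ↔ (q : ℝ) < y) : x = y :=
  le_antisymm (le_of_forall_rat_lt fun q => (h q).1) (le_of_forall_rat_lt fun q => (h q).2)

/-- Order automorphisms of `ℚ` extend to `ℝ`. -/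
noncomputable def realExtensionHom : (ℚ ≃o ℚ) →* (ℝ ≃o ℝ) :=
  orderAutHom realExtension
    (fun x => eq_of_forall_rat_lt_iff fun q => lt_realExtension_iff 1 x q)
    (fun f g x => eq_of_forall_rat_lt_iff fun q => by
      have h1 := lt_realExtension_iff (f * g) x (g⁻¹ (f⁻¹ q))
      have h2 := lt_realExtension_iff f (realExtension g x) (f⁻¹ q)
      have h3 := lt_realExtension_iff g x (g⁻¹ (f⁻¹ q))
      simp only [RelIso.mul_apply, RelIso.apply_inv_self] at h1 h2 h3
      rw [h1, h2, h3])
    (fun f x y hxy => by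
      obtain ⟨q, h1, h2⟩ := exists_rat_btwn hxy
      have h3 : realExtension f x ≤ f q := by
        rw [← not_lt, lt_realExtension_iff]
        exact h1.le.not_gt
      exact h3.trans_lt ((lt_realExtension_iff f y q).2 h2))

theorem realExtensionHom_injective : Function.Injective realExtensionHom := by
  refine (injective_iff_map_eq_one _).2 fun f hf => ?_
  ext q
  have h : ∀ x, realExtension f x = x := fun x => DFunLike.congr_fun hf x
  refine le_antisymm ?_ ?_
  · by_contra! hq
    have := lt_realExtension_iff f (f q) q
    rw [h] at this
    have h2 : (q : ℝ) < f q := by exact_mod_cast hq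
    exact lt_irrefl _ (this.2 h2)
  · by_contra! hq
    have := lt_realExtension_iff f q q
    rw [h] at this
    have h2 : (f q : ℝ) < q := by exact_mod_cast hq
    exact lt_irrefl _ (this.1 h2)

end Completion

/-! ### Periodic copies of automorphisms of the line -/

section Periodic

/-- The copy on the unit interval of a self-map of the line, fixing the other reals. -/
noncomputable def unitCopy (f : ℝ → ℝ) : ℝ → ℝ :=
  Function.extend Real.sigmoid (fun x => Real.sigmoid (f x)) id

theorem unitCopy_sigmoid (f : ℝ → ℝ) (x : ℝ) :
    unitCopy f (Real.sigmoid x) = Real.sigmoid (f x) :=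
  Real.sigmoid_injective.extend_apply _ _ _

theorem unitCopy_zero (f : ℝ → ℝ) : unitCopy f 0 = 0 := by
  refine Function.extend_apply' _ _ _ ?_
  rintro ⟨x, hx⟩
  exact (Real.sigmoid_pos x).ne' hx

theorem eq_zero_or_eq_sigmoid {t : ℝ} (ht : t ∈ Set.Ico (0 : ℝ) 1) :
    t = 0 ∨ ∃ x, t = Real.sigmoid x := by
  rcases ht.1.eq_or_lt with h | h
  · exact Or.inl h.symm
  · have : t ∈ Set.range Real.sigmoid := Real.range_sigmoid ▸ ⟨h, ht.2⟩
    obtain ⟨x, hx⟩ := this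
    exact Or.inr ⟨x, hx.symm⟩

theorem unitCopy_mem (f : ℝ → ℝ) {t : ℝ} (ht : t ∈ Set.Ico (0 : ℝ) 1) :
    unitCopy f t ∈ Set.Ico (0 : ℝ) 1 := by
  rcases eq_zero_or_eq_sigmoid ht with rfl | ⟨x, rfl⟩
  · simp [unitCopy_zero]
  · rw [unitCopy_sigmoid]
    exact ⟨(Real.sigmoid_pos _).le, Real.sigmoid_lt_one _⟩

theorem unitCopy_lt {f : ℝ → ℝ} (hf : StrictMono f) {t t' : ℝ} (ht : t ∈ Set.Ico (0 : ℝ) 1)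
    (ht' : t' ∈ Set.Ico (0 : ℝ) 1) (h : t < t') : unitCopy f t < unitCopy f t' := by
  rcases eq_zero_or_eq_sigmoid ht' with rfl | ⟨y, rfl⟩
  · exact absurd h ht.1.not_gt
  · rcases eq_zero_or_eq_sigmoid ht with rfl | ⟨x, rfl⟩
    · rw [unitCopy_zero, unitCopy_sigmoid]
      exact Real.sigmoid_pos _
    · rw [unitCopy_sigmoid, unitCopy_sigmoid, Real.sigmoid_lt_iff]
      exact hf (Real.sigmoid_lt_iff.1 h)

/-- The periodic map that restricts to a copy of a self-map of the line on each unit interval. -/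
noncomputable def periodicCopy (f : ℝ → ℝ) (x : ℝ) : ℝ := ⌊x⌋ + unitCopy f (Int.fract x)

theorem fract_mem (x : ℝ) : Int.fract x ∈ Set.Ico (0 : ℝ) 1 :=
  ⟨Int.fract_nonneg x, Int.fract_lt_one x⟩

theorem floor_periodicCopy (f : ℝ → ℝ) (x : ℝ) : ⌊periodicCopy f x⌋ = ⌊x⌋ := by
  have := unitCopy_mem f (fract_mem x)
  rw [periodicCopy, Int.floor_intCast_add, Int.floor_eq_zero_iff.2 this, add_zero]

theorem fract_periodicCopy (f : ℝ → ℝ) (x : ℝ) :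
    Int.fract (periodicCopy f x) = unitCopy f (Int.fract x) := by
  rw [Int.fract, floor_periodicCopy, periodicCopy, add_sub_cancel_left]

theorem periodicCopy_add_one (f : ℝ → ℝ) (x : ℝ) :
    periodicCopy f (x + 1) = periodicCopy f x + 1 := by
  simp only [periodicCopy, Int.floor_add_one, Int.fract_add_one, Int.cast_add, Int.cast_one]
  ring

theorem periodicCopy_zero (f : ℝ → ℝ) : periodicCopy f 0 = 0 := by
  simp [periodicCopy, unitCopy_zero]

theorem strictMono_periodicCopy {f : ℝ → ℝ} (hf : StrictMono f) :
    StrictMono (periodicCopy f) := by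
  intro x y hxy
  rcases (Int.floor_mono hxy.le).lt_or_eq with h | h
  · rw [← floor_periodicCopy f x, ← floor_periodicCopy f y] at h
    by_contra! h'
    exact absurd (Int.floor_mono h') h.not_ge
  · have h1 : Int.fract x < Int.fract y := by
      rw [Int.fract, Int.fract, h]
      linarith
    have := unitCopy_lt hf (fract_mem x) (fract_mem y) h1
    rw [periodicCopy, periodicCopy, h]
    linarith

/-- The group of order automorphisms of the line embeds in the subgroup of those that commute with
the unit translation. -/
noncomputable def periodicHom : (ℝ ≃o ℝ) →* (ℝ ≃o ℝ) :=
  orderAutHom (fun f => periodicCopy f)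
    (fun x => by
      rcases eq_zero_or_eq_sigmoid (fract_mem x) with h | ⟨y, h⟩
      · rw [periodicCopy, h, unitCopy_zero, ← h, Int.floor_add_fract]
      · rw [periodicCopy, h, unitCopy_sigmoid, RelIso.coe_one, id, ← h, Int.floor_add_fract])
    (fun f g x => by
      rw [periodicCopy, periodicCopy, floor_periodicCopy, fract_periodicCopy]
      congr 1
      rcases eq_zero_or_eq_sigmoid (fract_mem x) with h | ⟨y, h⟩
      · rw [h, unitCopy_zero, unitCopy_zero, unitCopy_zero]
      · rw [h, unitCopy_sigmoid, unitCopy_sigmoid, unitCopy_sigmoid, RelIso.mul_apply])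
    (fun f => strictMono_periodicCopy f.strictMono)

theorem periodicHom_apply (f : ℝ ≃o ℝ) (x : ℝ) : periodicHom f x = periodicCopy f x := rfl

theorem eq_one_of_periodicCopy {f : ℝ ≃o ℝ}
    (h : ∀ x ∈ Set.Ico (0 : ℝ) 1, periodicCopy f x = x) : f = 1 := by
  ext x
  have hx : Real.sigmoid x ∈ Set.Ico (0 : ℝ) 1 :=
    ⟨(Real.sigmoid_pos _).le, Real.sigmoid_lt_one _⟩
  have h1 := congrArg Int.fract (h _ hx)
  rw [fract_periodicCopy, Int.fract_eq_self.2 hx, unitCopy_sigmoid] at h1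
  exact Real.sigmoid_injective h1

end Periodic

/-! ### From the line to the circle with a fixed point -/

section Circle

/-- An order automorphism of the line, as an orientation-preserving homeomorphism. -/
noncomputable def orderAutToHomeo : (ℝ ≃o ℝ) →* HomeoPlusReal where
  toFun f := ⟨f.toHomeomorph, fun _ _ => f.lt_iff_lt⟩
  map_one' := rfl
  map_mul' _ _ := rfl

theorem orderAutToHomeo_injective : Function.Injective orderAutToHomeo := by
  intro f g h
  ext x
  exact DFunLike.congr_fun (congrArg Subtype.val h) x

theorem periodic_coe_periodicHom (f : ℝ ≃o ℝ) :
    Function.Periodic (fun x => (periodicHom f x : S1)) 1 := by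
  intro x
  simp only [periodicHom_apply, periodicCopy_add_one]
  exact AddCircle.coe_add_period 1 _

/-- The self-map of the circle covered by a periodic copy of an order automorphism of the line. -/
noncomputable def circleMap (f : ℝ ≃o ℝ) : S1 → S1 := (periodic_coe_periodicHom f).lift

theorem circleMap_coe (f : ℝ ≃o ℝ) (x : ℝ) : circleMap f (x : S1) = (periodicHom f x : S1) :=
  (periodic_coe_periodicHom f).lift_coe x

theorem circleMap_mul (f g : ℝ ≃o ℝ) (x : S1) :
    circleMap (f * g) x = circleMap f (circleMap g x) := by
  obtain ⟨x, -, rfl⟩ := exists_coe_mem_Ico 0 x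
  simp only [circleMap_coe, map_mul, RelIso.mul_apply]

theorem circleMap_one (x : S1) : circleMap 1 x = x := by
  obtain ⟨x, -, rfl⟩ := exists_coe_mem_Ico 0 x
  simp only [circleMap_coe, map_one, RelIso.one_apply]

theorem continuous_circleMap (f : ℝ ≃o ℝ) : Continuous (circleMap f) := by
  refine (QuotientAddGroup.isQuotientMap_mk (AddSubgroup.zmultiples (1 : ℝ))).continuous_iff.2 ?_
  have h : Continuous fun x : ℝ => (periodicHom f x : S1) :=
    (AddCircle.continuous_mk' 1).comp (periodicHom f).continuous
  exact h

theorem sbtw_circleMap (f : ℝ ≃o ℝ) (x y z : S1) :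
    sbtw (circleMap f x) (circleMap f y) (circleMap f z) ↔ sbtw x y z := by
  obtain ⟨a, -, rfl⟩ := exists_coe_mem_Ico 0 x
  obtain ⟨b, hb, rfl⟩ := exists_coe_mem_Ioc a y
  obtain ⟨c, hc, rfl⟩ := exists_coe_mem_Ico a z
  have h1 : periodicHom f a + 1 = periodicHom f (a + 1) := (periodicCopy_add_one f a).symm
  rw [circleMap_coe, circleMap_coe, circleMap_coe, sbtw_coe_iff hb hc, sbtw_coe_iff,
    OrderIso.lt_iff_lt]
  · rw [h1]
    exact ⟨(periodicHom f).lt_iff_lt.2 hb.1, (periodicHom f).le_iff_le.2 hb.2⟩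
  · rw [h1]
    exact ⟨(periodicHom f).le_iff_le.2 hc.1, (periodicHom f).lt_iff_lt.2 hc.2⟩

/-- Order automorphisms of the line act on the circle, regarded as its one-point
compactification. -/
noncomputable def circleHom : (ℝ ≃o ℝ) →* HomeoPlusCircle where
  toFun f :=
    ⟨{  toFun := circleMap f
        invFun := circleMap f⁻¹
        left_inv := fun x => by rw [← circleMap_mul, inv_mul_cancel, circleMap_one]
        right_inv := fun x => by rw [← circleMap_mul, mul_inv_cancel, circleMap_one]
        continuous_toFun := continuous_circleMap f
        continuous_invFun := continuous_circleMap f⁻¹ }, sbtw_circleMap f⟩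
  map_one' := Subtype.ext (Homeomorph.ext circleMap_one)
  map_mul' f g := Subtype.ext (Homeomorph.ext (circleMap_mul f g))

theorem circleHom_zero (f : ℝ ≃o ℝ) : (circleHom f).1 0 = 0 := by
  have h := circleMap_coe f 0
  rw [periodicHom_apply, periodicCopy_zero] at h
  exact h

theorem circleHom_injective : Function.Injective circleHom := by
  refine (injective_iff_map_eq_one _).2 fun f hf => eq_one_of_periodicCopy fun x hx => ?_
  have h : circleMap f x = x := DFunLike.congr_fun (congrArg Subtype.val hf) (x : S1)
  rw [circleMap_coe, periodicHom_apply] at h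
  -- Equality on the circle gives equal fractional parts; integer parts are preserved by
  -- construction, so the lift itself fixes `x`.
  have hx' : Int.fract (periodicCopy f x) = Int.fract x := by
    rw [← sub_eq_zero, ← AddCircle.coe_sub] at h
    obtain ⟨n, hn⟩ := (AddCircle.coe_eq_zero_iff (1 : ℝ)).1 h
    have : periodicCopy f x = x + n := by
      simp only [zsmul_eq_mul, mul_one] at hn
      linarith
    rw [this, Int.fract_add_intCast]
  have h2 := floor_periodicCopy f x
  rw [← Int.floor_add_fract (periodicCopy f x), hx', h2, Int.floor_add_fract]

end Circle

/-! ### A faithful action of the free group on a countable dense order -/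

section FreeAction

/-- For large `n` the map `x ↦ ⌊n * x⌋` is injective on the finitely many generators needed for `g`,
so a left inverse on them recovers `g`. -/
theorem exists_map_floor_ne_one {g : FreeGroup ℝ} (hg : g ≠ 1) :
    ∃ n : ℕ, FreeGroup.map (fun x : ℝ => ⌊n * x⌋) g ≠ 1 := by
  obtain ⟨F, hF⟩ := exists_finset_mem_freeSub g
  have h1 : ∀ᶠ n : ℕ in Filter.atTop, ∀ x ∈ F, ∀ y ∈ F, ⌊n * x⌋ = ⌊n * y⌋ → x = y := by
    rw [Filter.eventually_all_finset]
    intro x _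
    rw [Filter.eventually_all_finset]
    intro y _
    by_cases hxy : x = y
    · exact Filter.Eventually.of_forall fun n _ => hxy
    · have hpos : 0 < |x - y| := abs_pos.2 (sub_ne_zero.2 hxy)
      obtain ⟨N, hN⟩ := exists_nat_ge (1 / |x - y|)
      filter_upwards [Filter.eventually_ge_atTop N] with n hn h
      exfalso
      have h2 := Int.abs_sub_lt_one_of_floor_eq_floor h
      rw [← mul_sub, abs_mul, Nat.abs_cast] at h2
      have h3 : (N : ℝ) ≤ n := by exact_mod_cast hn
      have h4 := (div_le_iff₀ hpos).1 (hN.trans h3)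
      linarith
  obtain ⟨n, hn⟩ := h1.exists
  refine ⟨n, fun h => hg ?_⟩
  have hinv : Set.LeftInvOn (Function.invFunOn (fun x : ℝ => ⌊n * x⌋) F) (fun x : ℝ => ⌊n * x⌋) F :=
    Set.InjOn.leftInvOn_invFunOn fun x hx y hy => hn x hx y hy
  have h2 : ((FreeGroup.map (Function.invFunOn (fun x : ℝ => ⌊n * x⌋) F)).comp
      (FreeGroup.map (fun x : ℝ => ⌊n * x⌋))) g = MonoidHom.id _ g := by
    refine MonoidHom.eqOn_closure ?_ hF
    rintro _ ⟨x, hx, rfl⟩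
    simpa using congrArg FreeGroup.of (hinv hx)
  rw [MonoidHom.comp_apply, h, map_one] at h2
  exact h2.symm

/-- A countable dense linear order with a faithful action of the free group on the reals. -/
abbrev DenseModel : Type := (ℕ ×ₗ FreeGroup ℤ) ×ₗ ℚ

/-- The action of the free group on the reals on its countable quotients. -/
noncomputable def denseModelAct (g : FreeGroup ℝ) (x : DenseModel) : DenseModel :=
  toLex (toLex ((ofLex (ofLex x).1).1,
    FreeGroup.map (fun y : ℝ => ⌊((ofLex (ofLex x).1).1 : ℝ) * y⌋) g * (ofLex (ofLex x).1).2),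
    (ofLex x).2)

theorem strictMono_denseModelAct (g : FreeGroup ℝ) : StrictMono (denseModelAct g) := by
  intro x y h
  obtain ⟨⟨⟨n, a⟩, q⟩, rfl⟩ : ∃ z : (ℕ × FreeGroup ℤ) × ℚ, x = toLex (toLex z.1, z.2) :=
    ⟨(ofLex (ofLex x).1, (ofLex x).2), rfl⟩
  obtain ⟨⟨⟨n', a'⟩, q'⟩, rfl⟩ : ∃ z : (ℕ × FreeGroup ℤ) × ℚ, y = toLex (toLex z.1, z.2) :=
    ⟨(ofLex (ofLex y).1, (ofLex y).2), rfl⟩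
  simp only [denseModelAct, Prod.Lex.toLex_lt_toLex, ofLex_toLex, EmbeddingLike.apply_eq_iff_eq,
    Prod.mk.injEq] at h ⊢
  rcases h with (h | ⟨rfl, h⟩) | ⟨⟨rfl, rfl⟩, h⟩
  · exact Or.inl (Or.inl h)
  · exact Or.inl (Or.inr ⟨rfl, strictMono_mul_left_freeGroup _ h⟩)
  · exact Or.inr ⟨⟨rfl, rfl⟩, h⟩

/-- The factor `ℚ` makes the order dense without endpoints, so Cantor's theorem identifies it with
`ℚ`. Faithfulness is tested at the identity of the `n`-th copy of `FreeGroup ℤ`. -/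
theorem exists_injective_hom_rat :
    ∃ ρ : FreeGroup ℝ →* (ℚ ≃o ℚ), Function.Injective ρ := by
  have : Countable (FreeGroup ℤ) := Quot.mk_surjective.countable
  have : Countable (ℕ ×ₗ FreeGroup ℤ) := inferInstanceAs (Countable (ℕ × FreeGroup ℤ))
  have : Countable DenseModel := inferInstanceAs (Countable ((ℕ ×ₗ FreeGroup ℤ) × ℚ))
  have : Nonempty DenseModel := ⟨toLex (toLex (0, 1), 0)⟩
  obtain ⟨e⟩ := Order.iso_of_countable_dense DenseModel ℚ
  refine ⟨orderAutHom (fun g q => e (denseModelAct g (e.symm q))) ?_ ?_ ?_, ?_⟩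
  · intro x
    simp [denseModelAct]
  · intro g h x
    simp [denseModelAct, mul_assoc]
  · intro g
    exact e.strictMono.comp ((strictMono_denseModelAct g).comp e.symm.strictMono)
  · refine (injective_iff_map_eq_one _).2 fun g hg => ?_
    by_contra hne
    obtain ⟨n, hn⟩ := exists_map_floor_ne_one hne
    have h : e (denseModelAct g (e.symm (e (toLex (toLex (n, 1), 0))))) =
      e (toLex (toLex (n, 1), 0)) := DFunLike.congr_fun hg _
    rw [e.symm_apply_apply, e.apply_eq_iff_eq] at h
    apply hn
    have h2 := congrArg (fun x : DenseModel => (ofLex (ofLex x).1).2) h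
    simpa [denseModelAct] using h2

theorem exists_injective_hom_orderAut :
    ∃ ρ : FreeGroup ℝ →* (ℝ ≃o ℝ), Function.Injective ρ := by
  obtain ⟨ρ, hρ⟩ := exists_injective_hom_rat
  exact ⟨realExtensionHom.comp ρ, realExtensionHom_injective.comp hρ⟩

end FreeAction

/-! ### Existence of natural orderings -/

/-- For a product of positive elements, the earlier of the two least moved points is moved upwards.
Comparability is asked only of moved points, so that the circle, whose base point is fixed, is
covered too. -/
theorem isLeftOrdering_isStdPositive {G Ω : Type*} [Group G] {v : G → Ω → Ω}
    (h_one : ∀ x, v 1 x = x) (h_mul : ∀ g h x, v (g * h) x = v g (v h x))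
    (h_inj : ∀ g, (∀ x, v g x = x) → g = 1) {lt : Ω → Ω → Prop}
    (lt_trans : ∀ x y z, lt x y → lt y z → lt x z) (lt_irrefl : ∀ x, ¬ lt x x)
    (h_mono : ∀ g x y, lt x y → lt (v g x) (v g y))
    (h_tot : ∀ g x, v g x ≠ x → lt x (v g x) ∨ lt (v g x) x)
    (r : Ω → Ω → Prop) [IsWellOrder Ω r] :
    IsLeftOrdering fun g h : G => IsStdPositive lt r (v (g⁻¹ * h)) := by
  refine isLeftOrdering_of_cone (P := fun g => IsStdPositive lt r (v g)) ?_ ?_ ?_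
  · rintro ⟨x, hx, -⟩
    exact hx (h_one x)
  · rintro g h ⟨x, hx, hxr, hxp⟩ ⟨y, hy, hyr, hyp⟩
    have hpos : ∀ z, (∀ w, r w z → v g w = w ∧ v h w = w) → lt z (v (g * h) z) →
        IsStdPositive lt r (v (g * h)) := fun z hz hlt =>
      ⟨z, fun h' => lt_irrefl z (by rwa [h'] at hlt),
        fun w hw => by rw [h_mul, (hz w hw).2, (hz w hw).1], hlt⟩
    rcases trichotomous_of r x y with hr | rfl | hr
    · refine hpos x (fun w hw => ⟨hxr w hw, hyr w (trans_of r hw hr)⟩) ?_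
      rwa [h_mul, hyr x hr]
    · refine hpos x (fun w hw => ⟨hxr w hw, hyr w hw⟩) ?_
      rw [h_mul]
      exact lt_trans _ _ _ hxp (h_mono g _ _ hyp)
    · refine hpos y (fun w hw => ⟨hxr w (trans_of r hw hr), hyr w hw⟩) ?_
      rw [h_mul]
      conv_lhs => rw [← hxr y hr]
      exact h_mono g _ _ hyp
  · intro g hg
    have hne : {x | v g x ≠ x}.Nonempty := by
      by_contra! h
      refine hg (h_inj g fun x => ?_)
      by_contra hx
      exact (h ▸ (show x ∈ {x | v g x ≠ x} from hx) : x ∈ (∅ : Set Ω))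
    have wf : WellFounded r := IsWellFounded.wf
    have hmin : ∀ w, r w (wf.min _ hne) → v g w = w := fun w hw => by
      by_contra h
      exact wf.not_lt_min _ h hw
    have hinv : ∀ w, v g⁻¹ (v g w) = w := fun w => by rw [← h_mul, inv_mul_cancel, h_one]
    have hmem : v g (wf.min _ hne) ≠ wf.min _ hne := wf.min_mem _ hne
    rcases h_tot g _ hmem with h | h
    · exact Or.inl ⟨_, hmem, hmin, h⟩
    · right
      have h1 := h_mono g⁻¹ _ _ h
      rw [hinv] at h1
      refine ⟨_, fun h' => lt_irrefl _ (by rwa [h'] at h1), fun w hw => ?_, h1⟩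
      conv_lhs => rw [← hmin w hw]
      exact hinv w

theorem isLeftOrdering_stdOrder {G : Type*} [Group G] (ρ : G →* HomeoPlusReal)
    (hρ : Function.Injective ρ) (r : ℝ → ℝ → Prop) [IsWellOrder ℝ r] :
    IsLeftOrdering fun g h => stdOrder r (ρ g) (ρ h) := by
  have h := isLeftOrdering_isStdPositive (v := fun g => (ρ g).1) (lt := fun a b : ℝ => a < b)
    (fun x => by rw [map_one]; rfl) (fun g h x => by rw [map_mul]; rfl)
    (fun g hg => hρ (by rw [map_one]; exact Subtype.ext (Homeomorph.ext hg)))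
    (fun _ _ _ => lt_trans) lt_irrefl (fun g x y => ((ρ g).2 x y).2)
    (fun g x hx => (lt_or_gt_of_ne hx).symm) r
  simpa only [stdOrder, map_mul, map_inv] using h

theorem exists_isLeftOrdering_isNatural {G : Type*} [Group G] (ρ : G →* HomeoPlusReal)
    (hρ : Function.Injective ρ) : ∃ lt : G → G → Prop, IsLeftOrdering lt ∧ IsNatural lt :=
  ⟨_, isLeftOrdering_stdOrder ρ hρ WellOrderingRel, WellOrderingRel, inferInstance, ρ, hρ,
    fun _ _ => Iff.rfl⟩

theorem exists_isWellOrder_min {Ω : Type*} (p : Ω) :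
    ∃ r : Ω → Ω → Prop, IsWellOrder Ω r ∧ ∀ x, ¬ r x p := by
  classical
  have wf : WellFounded (WellOrderingRel (α := Ω)) := IsWellFounded.wf
  refine ⟨Equiv.swap p (wf.min Set.univ ⟨p, trivial⟩) ⁻¹'o WellOrderingRel,
    (RelIso.preimage _ _).toRelEmbedding.isWellOrder, fun x hx => ?_⟩
  have hx : WellOrderingRel (Equiv.swap p (wf.min Set.univ ⟨p, trivial⟩) x)
    (Equiv.swap p (wf.min Set.univ ⟨p, trivial⟩) p) := hx
  rw [Equiv.swap_apply_left] at hx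
  exact wf.not_lt_min _ (Set.mem_univ _) hx

/-- As `p` is fixed, the lexicographic circular ordering reduces to the cyclic order of the
left-ordering of the stabilizer. -/
theorem exists_isCircularOrdering_isNaturalCircular {G : Type*} [Group G]
    (ρ : G →* HomeoPlusCircle) (hρ : Function.Injective ρ) {p : S1}
    (hp : ∀ g, (ρ g).1 p = p) :
    ∃ c : G → G → G → SignType, IsCircularOrdering c ∧ IsNaturalCircular c := by
  obtain ⟨r, hr, hrp⟩ := exists_isWellOrder_min p
  have h := isLeftOrdering_isStdPositive (v := fun g => (ρ g).1) (lt := fun a b : S1 => sbtw p a b)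
    (fun x => by rw [map_one]; rfl) (fun g h x => by rw [map_mul]; rfl)
    (fun g hg => hρ (by rw [map_one]; exact Subtype.ext (Homeomorph.ext hg)))
    (fun _ _ _ => sbtw_trans_right) (fun _ => sbtw_irrefl_right)
    (fun g x y hxy => by
      have := ((ρ g).2 p x y).2 hxy
      rwa [hp] at this)
    (fun g x hx => by
      have h1 : p ≠ x := by
        rintro rfl
        exact hx (hp g)
      have h2 : (ρ g).1 x ≠ p := fun h => h1 ((ρ g).1.injective (h.trans (hp g).symm)).symm
      exact (sbtw_or_sbtw h1 hx.symm h2).imp id fun h => h.cyclic_right) r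
  refine ⟨_, isCircularOrdering_cyclicOrder h, r, hr, p, hrp, ρ, hρ, fun f g k => ?_⟩
  have hcoset : ∀ f g, cosetLT r p (ρ f) (ρ g) ↔
      IsStdPositive (fun a b : S1 => sbtw p a b) r (ρ (f⁻¹ * g)).1 := by
    intro f g
    rw [cosetLT, hp, hp, map_mul, map_inv]
    simp
  have htriple : ∀ f g k, IsCyclicTriple
      (fun g h => IsStdPositive (fun a b : S1 => sbtw p a b) r (ρ (g⁻¹ * h)).1) f g k =
      stdPosTriple r p (ρ f) (ρ g) (ρ k) := by
    intro f g k
    simp [IsCyclicTriple, stdPosTriple, hcoset, hp, sbtw_irrefl]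
  rw [cyclicOrder, stdCircular, htriple, htriple]

end NatOrd

theorem proposition3p4 :
    -- an ordering of `F(X)` with every `F(X_S)` convex exists
    (∃ lt : FreeGroup ℝ → FreeGroup ℝ → Prop, NatOrd.IsInitiallyConvexOrdering lt) ∧
    -- every such ordering is unnatural
    (∀ lt : FreeGroup ℝ → FreeGroup ℝ → Prop,
      NatOrd.IsInitiallyConvexOrdering lt → ¬ NatOrd.IsNatural lt) ∧
    -- `F(X)` embeds in `Homeo₊(ℝ)`
    (∃ ρ : FreeGroup ℝ →* NatOrd.HomeoPlusReal, Function.Injective ρ) ∧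
    -- `F(X)` has both natural and unnatural orderings
    (∃ lt : FreeGroup ℝ → FreeGroup ℝ → Prop, NatOrd.IsLeftOrdering lt ∧ NatOrd.IsNatural lt) ∧
    (∃ lt : FreeGroup ℝ → FreeGroup ℝ → Prop, NatOrd.IsLeftOrdering lt ∧ ¬ NatOrd.IsNatural lt) ∧
    -- some group has both natural and unnatural circular orderings
    (∃ (G : Type) (_ : Group G),
      (∃ c : G → G → G → SignType, NatOrd.IsCircularOrdering c ∧ NatOrd.IsNaturalCircular c) ∧
      (∃ c : G → G → G → SignType, NatOrd.IsCircularOrdering c ∧ ¬ NatOrd.IsNaturalCircular c)) := by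
  obtain ⟨lt, hlt⟩ := NatOrd.exists_isInitiallyConvexOrdering
  obtain ⟨ρ, hρ⟩ := NatOrd.exists_injective_hom_orderAut
  have hline : Function.Injective (NatOrd.orderAutToHomeo.comp ρ) :=
    NatOrd.orderAutToHomeo_injective.comp hρ
  have hcircle : Function.Injective (NatOrd.circleHom.comp ρ) :=
    NatOrd.circleHom_injective.comp hρ
  exact ⟨⟨lt, hlt⟩, fun _ h => h.not_isNatural, ⟨_, hline⟩,
    NatOrd.exists_isLeftOrdering_isNatural _ hline, ⟨lt, hlt.1, hlt.not_isNatural⟩,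
    FreeGroup ℝ, inferInstance,
    NatOrd.exists_isCircularOrdering_isNaturalCircular _ hcircle
      fun g => NatOrd.circleHom_zero (ρ g),
    ⟨_, NatOrd.isCircularOrdering_cyclicOrder hlt.1, hlt.not_isNaturalCircular⟩⟩
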